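/- **Conventions.** A *model category* is a category with finite limits and finite colimits and a model structure in Quillen's sense (lifting, non-functorial factorizations, closure under retracts, 2-out-of-3). Fix a notion of smallness; "filtered colimit" means small filtered colimit. An object $K$ is *compact* if $\mathrm{Hom}(K,-)$ commutes with filtered colimits, and $\mathcal V^{cmpt}\subseteq\mathcal V$ is the full subcategory of compact objects. A *monoidal model category* $(\mathcal V,\otimes,I)$ is a model category with a monoidal structure satisfying the pushout-product axiom and the unit axiom; $\otimes$ need not be closed or symmetric. $\mathcal V$ is *quotient compatible* if it has filtered colimits, $\otimes$ commutes with filtered colimits in each variable, $I$ is compact, and fibrations and trivial fibrations are closed under filtered colimits. A *$\mathcal V$-compactly enriched model category* is a model category $\mathcal M$ with: a $\mathcal V$-enrichment $\mathrm{Map}(-,-)$ whose underlying category is $\mathcal M$, so $\mathrm{Hom}_{\mathcal V}(I,\mathrm{Map}(X,Y))=\mathrm{Hom}_{\mathcal M}(X,Y)$; functors $-\otimes-\colon\mathcal M\times\mathcal V^{cmpt}\to\mathcal M$ and $(-)^{(-)}\colon(\mathcal V^{cmpt})^{op}\times\mathcal M\to\mathcal M$ with isomorphisms $\mathrm{Hom}(X\otimes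 K,Y)\cong\mathrm{Hom}(X,Y^K)\cong\mathrm{Hom}(K,\mathrm{Map}(X,Y))$ natural in $X,Y,K$; and such that for each cofibration $i\colon A\to B$ and fibration $p\colon Y\to X$ the map $\mathrm{Map}(B,Y)\to\mathrm{Map}(B,X)\times_{\mathrm{Map}(A,X)}\mathrm{Map}(A,Y)$ is a fibration, which is trivial if $i$ or $p$ is. Let $\mathcal M$ be a model category. An object $U$ is *discrete homotopically subterminal* if it is fibrant and subterminal and its diagonal $U\to U\times U$ is a weak equivalence. Order such objects by $U\le W$ iff $\mathrm{Hom}(U,W)\neq\emptyset$. A *model filter* $\Phi$ is a filter for this preorder (non-empty, upward closed, any two members have a common lower bound in $\Phi$) such that for each cofibration (weak equivalence) $f$ and $U\in\Phi$ the map $f\times U$ is a cofibration (weak equivalence). The *filter quotient* $\mathcal M_\Phi$ has the objects of $\mathcal M$; its morphisms $X\to Y$ are classes of morphisms $X\times U\to Y$ with $U\in\Phi$, where $f\colon X\times U\to Y$ and $g\colon X\times U'\to Y$ are identified if they agree on $X\times W$ for some $W\le U,U'$ in $\Phi$. The functor $P_\Phi\colon\mathcal M\to\mathcal M_\Phi$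 is the identity on objects and sends $f$ to its class. For a class $S$ of morphisms of $\mathcal M$ let $S_\Phi$ consist of the morphisms of $\mathcal M_\Phi$ that have a representative $f\colon X\times U\to Y$, $U\in\Phi$, with $(f,\mathrm{pr}_U)\colon X\times U\to Y\times U$ in $S$. If $\mathcal M$ is $\mathcal V$-compactly enriched, a model filter $\Phi$ is *$\mathcal V$-enriched* if for all $X\in\mathcal M$, $K\in\mathcal V^{cmpt}$ and $U\in\Phi$ there is an isomorphism $(X\otimes K)\times U\cong(X\times U)\otimes K$ compatible with the canonical maps to $X\otimes K$. **Theorem.** Let $\mathcal V$ be a quotient compatible monoidal model category in which filtered colimits commute with finite limits. Let $\mathcal M$ be a $\mathcal V$-compactly enriched model category and $\Phi$ an essentially small $\mathcal V$-enriched model filter on $\mathcal M$ such that, for every $U\in\Phi$, - the functor $U\times-\colon\mathcal M\to\mathcal M$ preserves pushouts, and - for all $X,Y$ the projection induces an isomorphism $\mathrm{Map}(X\times U,Y\times U)\to\mathrm{Map}(X\times U,Y)$ (equivalently, $-\times U$ is a $\mathcal V$-functor with $\mathcal V$-natural projection $X\times U\to X$). These isomorphisms and restriction along $X\times W\to X\times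 U$ for $W\le U$ make $U\mapsto\mathrm{Map}(X\times U,Y\times U)$ a diagram $\Phi^{op}\to\mathcal V$, and restriction along $X\times U\to X$ gives maps $\mathrm{Map}(X,Y)\to\mathrm{Map}(X\times U,Y\times U)$. Then $\mathcal M_\Phi$ is a model category whose fibrations, cofibrations and weak equivalences are $\mathcal F_\Phi$, $\mathcal C_\Phi$, $\mathcal W_\Phi$, where $\mathcal F,\mathcal C,\mathcal W$ are those of $\mathcal M$. It admits a $\mathcal V$-compactly enriched structure with mapping objects $$\mathrm{Map}_{\mathcal M_\Phi}(X,Y)=\operatorname{colim}_{U\in\Phi}\mathrm{Map}_{\mathcal M}(X\times U,Y\times U),$$ such that the identification of $\mathrm{Hom}(I,\mathrm{Map}_{\mathcal M_\Phi}(X,Y))$ with $\mathrm{Hom}_{\mathcal M_\Phi}(X,Y)$ and the composition are induced by those of $\mathcal M$. Moreover $P_\Phi$ preserves tensors and cotensors: the canonical comparison maps $P_\Phi(X)\otimes K\to P_\Phi(X\otimes K)$ and $P_\Phi(Y^K)\to P_\Phi(Y)^K$, obtained from the universal maps $K\to\mathrm{Map}(X,X\otimes K)$ and $K\to\mathrm{Map}(Y^K,Y)$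 and from $\mathrm{Map}(X,Y)\to\mathrm{Map}_{\mathcal M_\Phi}(P_\Phi X,P_\Phi Y)$, are isomorphisms for all $X,Y\in\mathcal M$ and $K\in\mathcal V^{cmpt}$. -/

import Mathlib

open CategoryTheory Limits MonoidalCategory HomotopicalAlgebra Opposite

universe w v' u' v u

namespace FilterQuotientModel

noncomputable section

/-! ### Monoidal model categories -/

section Monoidal

variable (V : Type u') [Category.{v'} V] [MonoidalCategory V] [ModelCategory V]

/-- The pushout-product `(B ⊗ X) ⊔_{A ⊗ X} (A ⊗ Y) ⟶ B ⊗ Y` of `i : A ⟶ B` and `j : X ⟶ Y`. -/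
def pushoutProduct {V : Type u'} [Category.{v'} V] [MonoidalCategory V] [ModelCategory V]
    {A B X Y : V} (i : A ⟶ B) (j : X ⟶ Y) : pushout (i ▷ X) (A ◁ j) ⟶ B ⊗ Y :=
  pushout.desc (B ◁ j) (i ▷ Y) (whisker_exchange i j).symm

/-- The compatibility of a monoidal structure with a model structure: the pushout-product axiom
and the unit axiom. (Closedness of the monoidal structure is not required.) -/
class MonoidalModelCategory : Prop where
  cofibration_pushoutProduct {A B X Y : V} (i : A ⟶ B) (j : X ⟶ Y)
    [Cofibration i] [Cofibration j] : Cofibration (pushoutProduct i j)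
  weakEquivalence_pushoutProduct_left {A B X Y : V} (i : A ⟶ B) (j : X ⟶ Y)
    [Cofibration i] [Cofibration j] [WeakEquivalence i] : WeakEquivalence (pushoutProduct i j)
  weakEquivalence_pushoutProduct_right {A B X Y : V} (i : A ⟶ B) (j : X ⟶ Y)
    [Cofibration i] [Cofibration j] [WeakEquivalence j] : WeakEquivalence (pushoutProduct i j)
  weakEquivalence_unit_whiskerRight {Q : V} (q : Q ⟶ 𝟙_ V) (X : V)
    [IsCofibrant Q] [WeakEquivalence q] [IsCofibrant X] : WeakEquivalence (q ▷ X)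
  weakEquivalence_unit_whiskerLeft {Q : V} (q : Q ⟶ 𝟙_ V) (X : V)
    [IsCofibrant Q] [WeakEquivalence q] [IsCofibrant X] : WeakEquivalence (X ◁ q)

/-- Quotient compatibility, with respect to `w`-small filtered colimits. -/
class QuotientCompatible : Prop extends HasFilteredColimitsOfSize.{w, w} V where
  preserves_tensorLeft (X : V) : PreservesFilteredColimitsOfSize.{w, w} (tensorLeft X)
  preserves_tensorRight (X : V) : PreservesFilteredColimitsOfSize.{w, w} (tensorRight X)
  compact_unit : IsFinitelyPresentable.{w} (𝟙_ V)
  fibrations_stable :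
    MorphismProperty.IsStableUnderFilteredColimits.{w, w} (fibrations V)
  trivialFibrations_stable :
    MorphismProperty.IsStableUnderFilteredColimits.{w, w} (trivialFibrations V)

end Monoidal

/-- The full subcategory of compact objects: those `K` such that `Hom(K, -)` preserves `w`-small
filtered colimits. -/
abbrev Compact (V : Type u') [Category.{v'} V] :=
  (ObjectProperty.isFinitelyPresentable.{w} V).FullSubcategory

/-! ### Compactly enriched model categories -/

section Enriched

variable (V : Type u') [Category.{v'} V] [MonoidalCategory V] [ModelCategory V]
  (M : Type u) [Category.{v} M]

/-- The map `Map(B, Y) ⟶ Map(B, X) ×_{Map(A, X)} Map(A, Y)` induced by `i : A ⟶ B` and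
`p : Y ⟶ X`. -/
def pullbackPower {M : Type u} [Category.{v} M] [EnrichedOrdinaryCategory V M]
    {A B X Y : M} (i : A ⟶ B) (p : Y ⟶ X) :
    (B ⟶[V] Y) ⟶ pullback (eHomWhiskerRight V i X) (eHomWhiskerLeft V A p) :=
  pullback.lift (eHomWhiskerLeft V B p) (eHomWhiskerRight V i Y) (eHom_whisker_exchange V i p)

/-- A compactly enriched structure over `V` on a model category `M`: an enrichment with underlying
category `M`, tensors and cotensors by the compact objects of `V`, and the pullback-power axiom. -/
class CompactlyEnriched [ModelCategory M] extends EnrichedOrdinaryCategory V M where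
  tensor : M ⥤ Compact.{w} V ⥤ M
  cotensor : (Compact.{w} V)ᵒᵖ ⥤ M ⥤ M
  tensorEquiv (X : M) (K : Compact.{w} V) (Y : M) :
    ((tensor.obj X).obj K ⟶ Y) ≃ (K.obj ⟶ (X ⟶[V] Y))
  cotensorEquiv (X : M) (K : Compact.{w} V) (Y : M) :
    (X ⟶ (cotensor.obj (op K)).obj Y) ≃ (K.obj ⟶ (X ⟶[V] Y))
  tensorEquiv_naturality {X X' Y Y' : M} {K K' : Compact.{w} V} (a : X' ⟶ X) (k : K' ⟶ K)
    (b : Y ⟶ Y') (f : (tensor.obj X).obj K ⟶ Y) :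
    tensorEquiv X' K' Y' ((tensor.map a).app K' ≫ (tensor.obj X).map k ≫ f ≫ b) =
      k.hom ≫ tensorEquiv X K Y f ≫ eHomWhiskerRight V a Y ≫ eHomWhiskerLeft V X' b
  cotensorEquiv_naturality {X X' Y Y' : M} {K K' : Compact.{w} V} (a : X' ⟶ X) (k : K' ⟶ K)
    (b : Y ⟶ Y') (f : X ⟶ (cotensor.obj (op K)).obj Y) :
    cotensorEquiv X' K' Y'
        (a ≫ f ≫ (cotensor.map k.op).app Y ≫ (cotensor.obj (op K')).map b) =
      k.hom ≫ cotensorEquiv X K Y f ≫ eHomWhiskerRight V a Y ≫ eHomWhiskerLeft V X' b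
  fibration_pullbackPower {A B X Y : M} (i : A ⟶ B) (p : Y ⟶ X) [Cofibration i] [Fibration p] :
    Fibration (pullbackPower V i p)
  weakEquivalence_pullbackPower_left {A B X Y : M} (i : A ⟶ B) (p : Y ⟶ X)
    [Cofibration i] [Fibration p] [WeakEquivalence i] : WeakEquivalence (pullbackPower V i p)
  weakEquivalence_pullbackPower_right {A B X Y : M} (i : A ⟶ B) (p : Y ⟶ X)
    [Cofibration i] [Fibration p] [WeakEquivalence p] : WeakEquivalence (pullbackPower V i p)

variable {M} [ModelCategory M] [CompactlyEnriched.{w} V M]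

/-- The tensor `X ⊗ K` of an object `X` with a compact object `K`. -/
abbrev tens (X : M) (K : Compact.{w} V) : M :=
  ((CompactlyEnriched.tensor (V := V) (M := M)).obj X).obj K

/-- The cotensor `Y ^ K` of an object `Y` by a compact object `K`. -/
abbrev cotens (K : Compact.{w} V) (Y : M) : M :=
  ((CompactlyEnriched.cotensor (V := V) (M := M)).obj (op K)).obj Y

/-- The morphism `X' ⊗ K ⟶ X ⊗ K` induced by `a : X' ⟶ X`. -/
abbrev tensMap {X' X : M} (a : X' ⟶ X) (K : Compact.{w} V) : tens V X' K ⟶ tens V X K :=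
  ((CompactlyEnriched.tensor (V := V) (M := M)).map a).app K

/-- The universal arrow `K ⟶ Map(X, X ⊗ K)`. -/
def tensUnit (X : M) (K : Compact.{w} V) : K.obj ⟶ (X ⟶[V] tens V X K) :=
  CompactlyEnriched.tensorEquiv X K _ (𝟙 _)

/-- The universal arrow `K ⟶ Map(Y ^ K, Y)`. -/
def cotensCounit (K : Compact.{w} V) (Y : M) : K.obj ⟶ (cotens V K Y ⟶[V] Y) :=
  CompactlyEnriched.cotensorEquiv _ K Y (𝟙 _)

end Enriched

/-! ### Model filters -/

/-- A discrete homotopically subterminal object: a fibrant subterminal object whose diagonal is a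
weak equivalence. -/
structure IsDiscreteSubterminal {M : Type u} [Category.{v} M] [ModelCategory M] (U : M) :
    Prop where
  isFibrant : IsFibrant U
  weakEquivalence_diag : WeakEquivalence (diag U)
  isSubterminal : IsSubterminal U

/-- A model filter: a filter in the preorder of discrete homotopically subterminal objects, such
that cofibrations and weak equivalences are stable under product with its members. -/
structure ModelFilter (M : Type u) [Category.{v} M] [ModelCategory M] where
  mem : ObjectProperty M
  discrete {U : M} (hU : mem U) : IsDiscreteSubterminal U
  nonempty : ∃ U, mem U
  upward {U W : M} (hU : mem U) (hW : IsDiscreteSubterminal W) (h : Nonempty (U ⟶ W)) : mem W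
  directed {U W : M} (hU : mem U) (hW : mem W) :
    ∃ Z, mem Z ∧ Nonempty (Z ⟶ U) ∧ Nonempty (Z ⟶ W)
  cofibration_prod {X Y U : M} (f : X ⟶ Y) (hf : Cofibration f) (hU : mem U) :
    Cofibration (prod.map f (𝟙 U))
  weakEquivalence_prod {X Y U : M} (f : X ⟶ Y) (hf : WeakEquivalence f) (hU : mem U) :
    WeakEquivalence (prod.map f (𝟙 U))

namespace ModelFilter

variable {M : Type u} [Category.{v} M] [ModelCategory M] (Φ : ModelFilter M)

variable {Φ} in
lemma hom_eq {U : M} (hU : Φ.mem U) {Z : M} (f g : Z ⟶ U) : f = g :=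
  (Φ.discrete hU).isSubterminal f g

/-! ### The filter quotient category -/

/-- Representatives `X × U ⟶ Y`, with `U` in the filter, of morphisms of the quotient. -/
structure Rep (X Y : M) where
  U : M
  mem : Φ.mem U
  hom : X ⨯ U ⟶ Y

variable {Φ}

/-- Two representatives are equivalent if they agree on `X × W` for some `W` in the filter. -/
def Rep.Rel {X Y : M} (r s : Φ.Rep X Y) : Prop :=
  ∃ W, Φ.mem W ∧ ∃ (a : W ⟶ r.U) (b : W ⟶ s.U),
    prod.map (𝟙 X) a ≫ r.hom = prod.map (𝟙 X) b ≫ s.hom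

/-- The composite of two representatives, over a common refinement `W`. -/
def Rep.comp {X Y Z : M} (r : Φ.Rep X Y) (s : Φ.Rep Y Z) {W : M} (hW : Φ.mem W)
    (a : W ⟶ r.U) (b : W ⟶ s.U) : Φ.Rep X Z :=
  ⟨W, hW, prod.lift (prod.map (𝟙 X) a ≫ r.hom) (prod.snd ≫ b) ≫ s.hom⟩

lemma Rep.Rel.refl {X Y : M} (r : Φ.Rep X Y) : r.Rel r :=
  ⟨r.U, r.mem, 𝟙 _, 𝟙 _, rfl⟩

lemma Rep.Rel.symm {X Y : M} {r s : Φ.Rep X Y} : r.Rel s → s.Rel r :=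
  fun ⟨W, hW, a, b, h⟩ => ⟨W, hW, b, a, h.symm⟩

lemma Rep.Rel.trans {X Y : M} {r s t : Φ.Rep X Y} : r.Rel s → s.Rel t → r.Rel t := by
  rintro ⟨W, hW, a, b, h⟩ ⟨W', hW', a', b', h'⟩
  obtain ⟨Z, hZ, ⟨z⟩, ⟨z'⟩⟩ := Φ.directed hW hW'
  refine ⟨Z, hZ, z ≫ a, z' ≫ b', ?_⟩
  have e : z ≫ b = z' ≫ a' := hom_eq s.mem _ _
  have h1 := congrArg (fun f => prod.map (𝟙 X) z ≫ f) h
  have h2 := congrArg (fun f => prod.map (𝟙 X) z' ≫ f) h'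
  simp only [prod.map_map_assoc, Category.comp_id] at h1 h2
  rw [h1, e, h2]

lemma Rep.Rel.comp {X Y Z : M} {r r' : Φ.Rep X Y} {s s' : Φ.Rep Y Z}
    (hr : r.Rel r') (hs : s.Rel s') {W W' : M} (hW : Φ.mem W) (hW' : Φ.mem W')
    (a : W ⟶ r.U) (b : W ⟶ s.U) (a' : W' ⟶ r'.U) (b' : W' ⟶ s'.U) :
    (r.comp s hW a b).Rel (r'.comp s' hW' a' b') := by
  obtain ⟨T, hT, t, t', ht⟩ := hr
  obtain ⟨S, hS, q, q', hq⟩ := hs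
  obtain ⟨Z₁, hZ₁, ⟨x⟩, ⟨x'⟩⟩ := Φ.directed hW hW'
  obtain ⟨Z₂, hZ₂, ⟨y⟩, ⟨y'⟩⟩ := Φ.directed hT hS
  obtain ⟨Z, hZ, ⟨z₁⟩, ⟨z₂⟩⟩ := Φ.directed hZ₁ hZ₂
  refine ⟨Z, hZ, z₁ ≫ x, z₁ ≫ x', ?_⟩
  have e1 : (z₁ ≫ x) ≫ a = (z₂ ≫ y) ≫ t := hom_eq r.mem _ _
  have e2 : (z₁ ≫ x) ≫ b = (z₂ ≫ y') ≫ q := hom_eq s.mem _ _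
  have e3 : (z₁ ≫ x') ≫ a' = (z₂ ≫ y) ≫ t' := hom_eq r'.mem _ _
  have e4 : (z₁ ≫ x') ≫ b' = (z₂ ≫ y') ≫ q' := hom_eq s'.mem _ _
  have h1 : prod.map (𝟙 X) ((z₁ ≫ x) ≫ a) ≫ r.hom =
      prod.map (𝟙 X) ((z₁ ≫ x') ≫ a') ≫ r'.hom := by
    rw [e1, e3]
    have := congrArg (fun f => prod.map (𝟙 X) (z₂ ≫ y) ≫ f) ht
    simpa only [prod.map_map_assoc, Category.comp_id] using this
  have h2 : ∀ g : X ⨯ Z ⟶ Y, prod.lift g (prod.snd ≫ (z₁ ≫ x) ≫ b) ≫ s.hom =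
      prod.lift g (prod.snd ≫ (z₁ ≫ x') ≫ b') ≫ s'.hom := by
    intro g
    rw [e2, e4]
    have := congrArg (fun f => prod.lift g (prod.snd ≫ z₂ ≫ y') ≫ f) hq
    simpa only [prod.lift_map_assoc, Category.comp_id, Category.assoc] using this
  change prod.map (𝟙 X) (z₁ ≫ x) ≫
      (prod.lift (prod.map (𝟙 X) a ≫ r.hom) (prod.snd ≫ b) ≫ s.hom) =
    prod.map (𝟙 X) (z₁ ≫ x') ≫
      (prod.lift (prod.map (𝟙 X) a' ≫ r'.hom) (prod.snd ≫ b') ≫ s'.hom)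
  simp only [prod.comp_lift_assoc, prod.map_map_assoc, prod.map_snd_assoc, Category.comp_id]
  rw [h1]
  simpa only [Category.assoc] using h2 _

lemma Rep.comp_assoc {X Y Z T : M} (r : Φ.Rep X Y) (s : Φ.Rep Y Z) (t : Φ.Rep Z T) {W : M}
    (hW : Φ.mem W) (a : W ⟶ r.U) (b : W ⟶ s.U) (c : W ⟶ t.U) :
    (r.comp s hW a b).comp t hW (𝟙 W) c = r.comp (s.comp t hW b c) hW a (𝟙 W) := by
  have key : ∀ (f : X ⨯ W ⟶ Y) (g : Y ⨯ s.U ⟶ Z) (h : Z ⨯ t.U ⟶ T),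
      prod.lift (prod.map (𝟙 X) (𝟙 W) ≫ prod.lift f (prod.snd ≫ b) ≫ g) (prod.snd ≫ c) ≫ h =
        prod.lift f (prod.snd ≫ 𝟙 W) ≫
          prod.lift (prod.map (𝟙 Y) b ≫ g) (prod.snd ≫ c) ≫ h := by
    intro f g h
    rw [prod.map_id_id, Category.id_comp, Category.comp_id, prod.comp_lift_assoc,
      prod.lift_map_assoc, prod.lift_snd_assoc, Category.comp_id]
  exact congrArg (Rep.mk W hW) (key _ _ _)

instance repSetoid (X Y : M) : Setoid (Φ.Rep X Y) where
  r := Rep.Rel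
  iseqv := ⟨Rep.Rel.refl, Rep.Rel.symm, Rep.Rel.trans⟩

/-- The filter quotient `M_Φ`: it has the same objects as `M`. -/
structure QuotientCat (Φ : ModelFilter M) where
  of ::
  /-- the underlying object of `M` -/
  base : M

namespace QuotientCat

/-- A morphism of the quotient is an equivalence class of representatives. -/
def Hom (X Y : Φ.QuotientCat) : Type (max u v) := _root_.Quotient (repSetoid (Φ := Φ) X.base Y.base)

/-- The class of the representative `f : X × U ⟶ Y`. -/
def mk {X Y : M} {U : M} (hU : Φ.mem U) (f : X ⨯ U ⟶ Y) : Hom (Φ := Φ) ⟨X⟩ ⟨Y⟩ :=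
  _root_.Quotient.mk (repSetoid (Φ := Φ) X Y) ⟨U, hU, f⟩

/-- Composition of classes of representatives. -/
def comp {X Y Z : Φ.QuotientCat} (f : Hom X Y) (g : Hom Y Z) : Hom X Z :=
  _root_.Quotient.liftOn₂ f g
    (fun r s => _root_.Quotient.mk _
      (r.comp s (Φ.directed r.mem s.mem).choose_spec.1
        (Φ.directed r.mem s.mem).choose_spec.2.1.some
        (Φ.directed r.mem s.mem).choose_spec.2.2.some))
    (fun _ _ _ _ hr hs => _root_.Quotient.sound (hr.comp hs _ _ _ _ _ _))

lemma comp_mk_mk {X Y Z : M} (r : Φ.Rep X Y) (s : Φ.Rep Y Z) {W : M} (hW : Φ.mem W)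
    (a : W ⟶ r.U) (b : W ⟶ s.U) :
    comp (X := ⟨X⟩) (Y := ⟨Y⟩) (Z := ⟨Z⟩) (_root_.Quotient.mk _ r) (_root_.Quotient.mk _ s) =
      _root_.Quotient.mk _ (r.comp s hW a b) :=
  _root_.Quotient.sound ((Rep.Rel.refl r).comp (Rep.Rel.refl s) _ _ _ _ _ _)

instance : Category (Φ.QuotientCat) where
  Hom := Hom
  id X := mk (X := X.base) (Y := X.base) Φ.nonempty.choose_spec prod.fst
  comp := comp
  id_comp {X Y} f := by
    induction f using _root_.Quotient.inductionOn with | h r =>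
    obtain ⟨Z, hZ, ⟨a⟩, ⟨b⟩⟩ := Φ.directed Φ.nonempty.choose_spec r.mem
    refine (comp_mk_mk _ r hZ a b).trans (_root_.Quotient.sound ⟨Z, hZ, 𝟙 _, b, ?_⟩)
    have : prod.lift (prod.map (𝟙 X.base) a ≫ prod.fst) (prod.snd ≫ b) =
        prod.map (𝟙 X.base) b := by
      ext <;> simp [prod.lift_fst, prod.lift_snd]
    simp only [Rep.comp, this, prod.map_id_id, Category.id_comp]
  comp_id {X Y} f := by
    induction f using _root_.Quotient.inductionOn with | h r =>
    obtain ⟨Z, hZ, ⟨a⟩, ⟨b⟩⟩ := Φ.directed r.mem Φ.nonempty.choose_spec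
    refine (comp_mk_mk r _ hZ a b).trans (_root_.Quotient.sound ⟨Z, hZ, 𝟙 _, a, ?_⟩)
    simp [Rep.comp, prod.lift_fst]
  assoc {X Y Z T} f g h := by
    induction f using _root_.Quotient.inductionOn with | h r =>
    induction g using _root_.Quotient.inductionOn with | h s =>
    induction h using _root_.Quotient.inductionOn with | h t =>
    obtain ⟨A, hA, ⟨a⟩, ⟨b⟩⟩ := Φ.directed r.mem s.mem
    obtain ⟨B, hB, ⟨a'⟩, ⟨c⟩⟩ := Φ.directed hA t.mem
    rw [comp_mk_mk r s hB (a' ≫ a) (a' ≫ b), comp_mk_mk s t hB (a' ≫ b) c]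
    refine (comp_mk_mk (r.comp s hB (a' ≫ a) (a' ≫ b)) t hB (𝟙 _) c).trans
      (Eq.trans ?_ (comp_mk_mk r (s.comp t hB (a' ≫ b) c) hB (a' ≫ a) (𝟙 _)).symm)
    exact congrArg _ (Rep.comp_assoc r s t hB (a' ≫ a) (a' ≫ b) c)

/-- The class of `f : X × U ⟶ Y`, as a morphism of the quotient category. -/
def homMk {X Y : M} {U : M} (hU : Φ.mem U) (f : X ⨯ U ⟶ Y) :
    (⟨X⟩ : Φ.QuotientCat) ⟶ ⟨Y⟩ :=
  mk hU f

lemma homMk_eq_homMk_iff {X Y : M} {U U' : M} (hU : Φ.mem U) (hU' : Φ.mem U')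
    (f : X ⨯ U ⟶ Y) (f' : X ⨯ U' ⟶ Y) :
    homMk hU f = homMk hU' f' ↔ ∃ W, Φ.mem W ∧ ∃ (a : W ⟶ U) (b : W ⟶ U'),
      prod.map (𝟙 X) a ≫ f = prod.map (𝟙 X) b ≫ f' :=
  _root_.Quotient.eq (r := repSetoid (Φ := Φ) X Y)

lemma homMk_comp_homMk {X Y Z : M} {U U' W : M} (hU : Φ.mem U) (hU' : Φ.mem U')
    (hW : Φ.mem W) (a : W ⟶ U) (b : W ⟶ U') (f : X ⨯ U ⟶ Y) (g : Y ⨯ U' ⟶ Z) :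
    homMk hU f ≫ homMk hU' g =
      homMk hW (prod.lift (prod.map (𝟙 X) a ≫ f) (prod.snd ≫ b) ≫ g) :=
  comp_mk_mk ⟨U, hU, f⟩ ⟨U', hU', g⟩ hW a b

end QuotientCat

variable (Φ)

/-- The projection functor `P_Φ : M ⥤ M_Φ`, the identity on objects. -/
def proj : M ⥤ Φ.QuotientCat where
  obj X := ⟨X⟩
  map f := QuotientCat.homMk Φ.nonempty.choose_spec (prod.fst ≫ f)
  map_comp {X Y Z} f g := by
    rw [QuotientCat.homMk_comp_homMk _ _ Φ.nonempty.choose_spec (𝟙 _) (𝟙 _)]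
    congr 1
    simp [prod.lift_fst_assoc]

/-- The class `S_Φ` of morphisms of `M_Φ` with a representative `f : X × U ⟶ Y` such that
`f × U : X × U ⟶ Y × U` is in `S`. -/
def quotientClass (S : MorphismProperty M) : MorphismProperty Φ.QuotientCat :=
  fun X Y φ => ∃ (U : M) (hU : Φ.mem U) (f : X.base ⨯ U ⟶ Y.base),
    φ = QuotientCat.homMk hU f ∧ S (prod.lift f (prod.snd : X.base ⨯ U ⟶ U))

/-! ### The induced enrichment -/

/-- Enriched model filters: the canonical map `(X × U) ⊗ K ⟶ X ⊗ K` exhibits `(X × U) ⊗ K` as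
`(X ⊗ K) × U`. -/
class IsEnriched (V : Type u') [Category.{v'} V] [MonoidalCategory V] [ModelCategory V]
    [CompactlyEnriched.{w} V M] : Prop where
  exists_iso (X : M) (K : Compact.{w} V) {U : M} (hU : Φ.mem U) :
    ∃ e : tens V X K ⨯ U ≅ tens V (X ⨯ U) K,
      e.hom ≫ tensMap V (prod.fst : X ⨯ U ⟶ X) K = prod.fst

/-- The products with members of the filter are compatible with the enrichment: postcomposition
with the projection `Y × U ⟶ Y` is an isomorphism `Map(X × U, Y × U) ≅ Map(X × U, Y)`.
This amounts to the functor `- × U` being a `V`-functor, `V`-naturally over the identity. -/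
class HasEnrichedProducts (V : Type u') [Category.{v'} V] [MonoidalCategory V]
    [EnrichedOrdinaryCategory V M] : Prop where
  isIso (X Y : M) {U : M} (hU : Φ.mem U) :
    IsIso (eHomWhiskerLeft V (X ⨯ U) (prod.fst : Y ⨯ U ⟶ Y))

section

variable (V : Type u') [Category.{v'} V] [MonoidalCategory V]
  [EnrichedOrdinaryCategory V M] [Φ.HasEnrichedProducts V]

instance (X Y : M) (U : Φ.mem.FullSubcategory) :
    IsIso (eHomWhiskerLeft V (X ⨯ U.obj) (prod.fst : Y ⨯ U.obj ⟶ Y)) :=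
  HasEnrichedProducts.isIso X Y U.property

/-- The action `Map(X, Y) ⟶ Map(X × U, Y × U)` of the functor `- × U` on mapping objects. -/
def prodMap (X Y : M) (U : Φ.mem.FullSubcategory) :
    (X ⟶[V] Y) ⟶ ((X ⨯ U.obj) ⟶[V] (Y ⨯ U.obj)) :=
  eHomWhiskerRight V (prod.fst : X ⨯ U.obj ⟶ X) Y ≫
    inv (eHomWhiskerLeft V (X ⨯ U.obj) (prod.fst : Y ⨯ U.obj ⟶ Y))

/-- The diagram `U ↦ Map(X × U, Y × U)`. For `W ≤ U`, the transition map is the unique one whose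
composite with `Map(X × W, Y × W) ≅ Map(X × W, Y)` is the restriction
`Map(X × U, Y × U) ⟶ Map(X × U, Y) ⟶ Map(X × W, Y)`. -/
def mapDiagram (X Y : M) : (Φ.mem.FullSubcategory)ᵒᵖ ⥤ V where
  obj U := ((X ⨯ U.unop.obj) ⟶[V] (Y ⨯ U.unop.obj))
  map {U W} h :=
    eHomWhiskerLeft V (X ⨯ U.unop.obj) (prod.fst : Y ⨯ U.unop.obj ⟶ Y) ≫
      eHomWhiskerRight V (prod.map (𝟙 X) h.unop.hom) Y ≫
        inv (eHomWhiskerLeft V (X ⨯ W.unop.obj) (prod.fst : Y ⨯ W.unop.obj ⟶ Y))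
  map_id U := by simp
  map_comp {U W Z} h k := by
    have : prod.map (𝟙 X) (h ≫ k).unop.hom =
        prod.map (𝟙 X) k.unop.hom ≫ prod.map (𝟙 X) h.unop.hom := by simp
    rw [this, eHomWhiskerRight_comp]
    simp

/-- An enrichment of `M_Φ` is the induced one if its mapping objects are the colimits
`colim_U Map(X × U, Y × U)`, in such a way that identification of the underlying morphisms
and the composition are induced by those of `M`. -/
structure InducedEnrichment [EnrichedOrdinaryCategory V Φ.QuotientCat] where
  ι (X Y : M) : Φ.mapDiagram V X Y ⟶
    (Functor.const _).obj (Φ.proj.obj X ⟶[V] Φ.proj.obj Y)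
  isColimit (X Y : M) : IsColimit (Cocone.mk _ (ι X Y))
  eHomEquiv_homMk {X Y : M} (U : Φ.mem.FullSubcategory) (f : X ⨯ U.obj ⟶ Y ⨯ U.obj) :
    eHomEquiv V (QuotientCat.homMk U.property (f ≫ prod.fst)) = eHomEquiv V f ≫ (ι X Y).app (op U)
  eComp_eq (X Y Z : M) (U : Φ.mem.FullSubcategory) :
    ((ι X Y).app (op U) ⊗ₘ (ι Y Z).app (op U)) ≫
        eComp V (Φ.proj.obj X) (Φ.proj.obj Y) (Φ.proj.obj Z) =
      eComp V (X ⨯ U.obj) (Y ⨯ U.obj) (Z ⨯ U.obj) ≫ (ι X Z).app (op U)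

/-- The morphism `Map(X, Y) ⟶ Map(P_Φ X, P_Φ Y)`, computed through the stage `U`
(it does not depend on `U`). -/
def InducedEnrichment.projMap {V : Type u'} [Category.{v'} V] [MonoidalCategory V]
    [EnrichedOrdinaryCategory V M] [Φ.HasEnrichedProducts V]
    [EnrichedOrdinaryCategory V Φ.QuotientCat] (I : Φ.InducedEnrichment V)
    (U : Φ.mem.FullSubcategory) (X Y : M) :
    (X ⟶[V] Y) ⟶ (Φ.proj.obj X ⟶[V] Φ.proj.obj Y) :=
  Φ.prodMap V X Y U ≫ (I.ι X Y).app (op U)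

end

section

variable {V : Type u'} [Category.{v'} V] [MonoidalCategory V] [ModelCategory V]
  [CompactlyEnriched.{w} V M] [Φ.HasEnrichedProducts V] [ModelCategory Φ.QuotientCat]
  [CompactlyEnriched.{w} V Φ.QuotientCat] (I : Φ.InducedEnrichment V) (U : Φ.mem.FullSubcategory)

/-- The comparison map `P_Φ X ⊗ K ⟶ P_Φ (X ⊗ K)`. -/
def tensComparison (X : M) (K : Compact.{w} V) :
    tens V (Φ.proj.obj X) K ⟶ Φ.proj.obj (tens V X K) :=
  (CompactlyEnriched.tensorEquiv _ K _).symm (tensUnit V X K ≫ I.projMap Φ U _ _)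

/-- The comparison map `P_Φ (Y ^ K) ⟶ (P_Φ Y) ^ K`. -/
def cotensComparison (K : Compact.{w} V) (Y : M) :
    Φ.proj.obj (cotens V K Y) ⟶ cotens V K (Φ.proj.obj Y) :=
  (CompactlyEnriched.cotensorEquiv _ K _).symm (cotensCounit V K Y ≫ I.projMap Φ U _ _)

end

end ModelFilter

end

end FilterQuotientModel

/-! Since a member `U` of the filter is subterminal, a morphism `X × U ⟶ Y` is the same as a
morphism `X × U ⟶ Y × U`. In this form composition in the quotient is composition in `M`
(`stage_comp`), and the quotient is a filtered colimit of such stages, with restriction `res` as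
transition. A finite diagram with finitely many equations is therefore realised in `M` at one
sufficiently small stage. This settles lifting, retracts and two-out-of-three, because the three
classes are stable under restriction (`ProdStable.res`): cofibrations and weak equivalences by
assumption, fibrations by base change. Trivial (co)fibrations are covered by `quotientClass_inf`.

The second principle is that `P_Φ (X × U) ≅ P_Φ X`, so every arrow of the quotient is isomorphic to
the image of an arrow of `M` (`stageIso`). Factorizations come directly from `M` in this way. So do
pullbacks and pushouts, as `P_Φ` preserves both; for pushouts this uses that `U × -` does.

For the enrichment, the transition maps respect composition (`eComp_trans`) and the tensor product
of `V` preserves filtered colimits, so composition passes to the colimits. Compactness of the unit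
identifies the underlying category. For tensors and cotensors, the universal arrows of `M`, moved to
the stage `U`, are again universal (`bijective_tensUnit_prodMap`, `bijective_cotensCounit_prodMap`).
Compactness of `K` carries this to the colimit, so `P_Φ (X ⊗ K)` and `P_Φ (Y ^ K)` are a tensor and
a cotensor in the quotient.

Finally, filtered colimits in `V` commute with pullbacks, so the pullback-power of `P_Φ i` and `P_Φ
p` is the filtered colimit of those of `i × U` and `p × U` (`pullbackPower_proj_map`), and (trivial)
fibrations are closed under such colimits. -/

namespace FilterQuotientModel

noncomputable section

namespace ModelFilter

variable {M : Type u} [Category.{v} M] [ModelCategory M] {Φ : ModelFilter M}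

/-! ### Morphisms of the quotient at a stage of the filter -/

/-- Second components agree because `U` is subterminal. Most identities at a stage are reduced to
first components in this way. -/
lemma prod_hom_ext {U : M} (hU : Φ.mem U) {Z Y : M} {f g : Z ⟶ Y ⨯ U}
    (h : f ≫ prod.fst = g ≫ prod.fst) : f = g :=
  Limits.prod.hom_ext h (hom_eq hU _ _)

/-- The restriction of `f : X × U ⟶ Y × U` along `W ≤ U`. -/
def res {X Y U W : M} (a : W ⟶ U) (f : X ⨯ U ⟶ Y ⨯ U) : X ⨯ W ⟶ Y ⨯ W :=
  prod.lift (prod.map (𝟙 X) a ≫ f ≫ prod.fst) prod.snd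

@[simp]
lemma res_fst {X Y U W : M} (a : W ⟶ U) (f : X ⨯ U ⟶ Y ⨯ U) :
    res a f ≫ prod.fst = prod.map (𝟙 X) a ≫ f ≫ prod.fst :=
  prod.lift_fst _ _

lemma res_map {X Y U W : M} (hU : Φ.mem U) (a : W ⟶ U) (f : X ⨯ U ⟶ Y ⨯ U) :
    res a f ≫ prod.map (𝟙 Y) a = prod.map (𝟙 X) a ≫ f :=
  prod_hom_ext hU (by simp)

lemma res_comp {X Y Z U W : M} (hU : Φ.mem U) (hW : Φ.mem W) (a : W ⟶ U)
    (f : X ⨯ U ⟶ Y ⨯ U) (g : Y ⨯ U ⟶ Z ⨯ U) : res a (f ≫ g) = res a f ≫ res a g :=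
  prod_hom_ext hW (by
    have := res_map hU a f
    simp [reassoc_of% this])

lemma res_id {X U W : M} (hW : Φ.mem W) (a : W ⟶ U) : res a (𝟙 (X ⨯ U)) = 𝟙 (X ⨯ W) :=
  prod_hom_ext hW (by simp)

lemma res_res {X Y U W Z : M} (hZ : Φ.mem Z) (a : W ⟶ U) (b : Z ⟶ W)
    (f : X ⨯ U ⟶ Y ⨯ U) : res b (res a f) = res (b ≫ a) f :=
  prod_hom_ext hZ (by simp)

lemma res_prodMap {X Y U W : M} (hW : Φ.mem W) (a : W ⟶ U) (f : X ⟶ Y) :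
    res a (prod.map f (𝟙 U)) = prod.map f (𝟙 W) :=
  prod_hom_ext hW (by simp)

/-- The morphism of the quotient represented by `f : X × U ⟶ Y × U`. -/
def stage {X Y U : M} (hU : Φ.mem U) (f : X ⨯ U ⟶ Y ⨯ U) : Φ.proj.obj X ⟶ Φ.proj.obj Y :=
  QuotientCat.homMk hU (f ≫ prod.fst)

lemma stage_eq_stage_iff {X Y U U' : M} (hU : Φ.mem U) (hU' : Φ.mem U') (f : X ⨯ U ⟶ Y ⨯ U)
    (f' : X ⨯ U' ⟶ Y ⨯ U') :
    stage hU f = stage hU' f' ↔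
      ∃ W, Φ.mem W ∧ ∃ (a : W ⟶ U) (b : W ⟶ U'), res a f = res b f' := by
  refine (QuotientCat.homMk_eq_homMk_iff _ _ _ _).trans ?_
  refine exists_congr fun W => and_congr_right fun hW => exists_congr fun a =>
    exists_congr fun b => ⟨fun h => prod_hom_ext hW (by simpa using h), fun h => ?_⟩
  simpa using congr($h ≫ prod.fst)

lemma stage_res {X Y U W : M} (hU : Φ.mem U) (hW : Φ.mem W) (a : W ⟶ U)
    (f : X ⨯ U ⟶ Y ⨯ U) : stage hW (res a f) = stage hU f :=
  (stage_eq_stage_iff _ _ _ _).2 ⟨W, hW, 𝟙 W, a, by rw [res_res hW, Category.id_comp]⟩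

/-- No refinement is needed at a common stage: the lift occurring in the composite of
representatives is `f` itself, as its second component is forced. -/
lemma stage_comp {X Y Z U : M} (hU : Φ.mem U) (f : X ⨯ U ⟶ Y ⨯ U) (g : Y ⨯ U ⟶ Z ⨯ U) :
    stage hU f ≫ stage hU g = stage hU (f ≫ g) := by
  refine (QuotientCat.homMk_comp_homMk hU hU hU (𝟙 U) (𝟙 U) _ _).trans ?_
  have : prod.lift (prod.map (𝟙 X) (𝟙 U) ≫ f ≫ prod.fst) (prod.snd ≫ 𝟙 U) = f :=
    prod_hom_ext hU (by simp [prod.lift_fst])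
  rw [this, stage, Category.assoc]

lemma stage_prodMap {X Y U : M} (hU : Φ.mem U) (f : X ⟶ Y) :
    stage hU (prod.map f (𝟙 U)) = Φ.proj.map f := by
  obtain ⟨W, hW, ⟨a⟩, ⟨b⟩⟩ := Φ.directed hU Φ.nonempty.choose_spec
  refine (QuotientCat.homMk_eq_homMk_iff _ _ _ _).2 ⟨W, hW, a, b, ?_⟩
  simp

lemma stage_id {X U : M} (hU : Φ.mem U) : stage hU (𝟙 (X ⨯ U)) = 𝟙 (Φ.proj.obj X) := by
  rw [← prod.map_id_id, stage_prodMap, CategoryTheory.Functor.map_id]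

lemma exists_eq_stage {X Y : M} (φ : Φ.proj.obj X ⟶ Φ.proj.obj Y) :
    ∃ (U : M) (hU : Φ.mem U) (f : X ⨯ U ⟶ Y ⨯ U), φ = stage hU f := by
  obtain ⟨⟨U, hU, f⟩, rfl⟩ := _root_.Quotient.exists_rep φ
  exact ⟨U, hU, prod.lift f prod.snd, congrArg (QuotientCat.homMk hU) (prod.lift_fst _ _).symm⟩

variable (Φ) in
lemma exists_eq_proj_obj (Z : Φ.QuotientCat) : ∃ X, Z = Φ.proj.obj X := ⟨Z.base, rfl⟩

/-! ### Properties holding eventually along the filter -/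

variable (Φ) in
/-- The property `p` holds for all sufficiently small members of the filter. -/
def Eventually (p : M → Prop) : Prop :=
  ∃ U, Φ.mem U ∧ ∀ W, Φ.mem W → (W ⟶ U) → p W

lemma Eventually.and {p q : M → Prop} (hp : Φ.Eventually p) (hq : Φ.Eventually q) :
    Φ.Eventually fun W => p W ∧ q W := by
  obtain ⟨U, hU, h⟩ := hp
  obtain ⟨U', hU', h'⟩ := hq
  obtain ⟨Z, hZ, ⟨a⟩, ⟨b⟩⟩ := Φ.directed hU hU'
  exact ⟨Z, hZ, fun W hW c => ⟨h W hW (c ≫ a), h' W hW (c ≫ b)⟩⟩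

lemma Eventually.exists {p : M → Prop} (hp : Φ.Eventually p) : ∃ U, Φ.mem U ∧ p U :=
  let ⟨U, hU, h⟩ := hp
  ⟨U, hU, h U hU (𝟙 U)⟩

lemma Eventually.of_le {U : M} (hU : Φ.mem U) : Φ.Eventually fun W => Nonempty (W ⟶ U) :=
  ⟨U, hU, fun _ _ a => ⟨a⟩⟩

/-- An equality witnessed at one stage persists below it, so finitely many equations can be realised
together through `Eventually.and`. The quantifier over `a` is harmless, since there is at most one
such arrow. -/
lemma Eventually.res_eq {X Y U : M} {hU : Φ.mem U} {f g : X ⨯ U ⟶ Y ⨯ U}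
    (h : stage hU f = stage hU g) :
    Φ.Eventually fun W => ∀ a : W ⟶ U, res a f = res a g := by
  obtain ⟨W, hW, a, b, h⟩ := (stage_eq_stage_iff _ _ _ _).1 h
  refine ⟨W, hW, fun Z hZ c d => ?_⟩
  have := congrArg (res c) h
  rw [res_res hZ, res_res hZ] at this
  rwa [hom_eq hU (c ≫ a) d, hom_eq hU (c ≫ b) d] at this

variable (Φ) in
/-- A property of morphisms which is stable under products with members of the filter. -/
class ProdStable (S : MorphismProperty M) : Prop extends S.RespectsIso where
  prodMap {X Y U : M} (hU : Φ.mem U) (f : X ⟶ Y) (hf : S f) : S (prod.map f (𝟙 U))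

/-- For `W ≤ U`, the projection `(X × U) × W ⟶ X × W` is an isomorphism. -/
@[simps]
def absorb (X : M) {U W : M} (hU : Φ.mem U) (hW : Φ.mem W) (a : W ⟶ U) :
    (X ⨯ U) ⨯ W ≅ X ⨯ W where
  hom := prod.map prod.fst (𝟙 W)
  inv := prod.lift (prod.map (𝟙 X) a) prod.snd
  hom_inv_id := prod_hom_ext hW (prod_hom_ext hU (by simp [prod.lift_fst_assoc]))
  inv_hom_id := prod_hom_ext hW (by simp)

/-- By `absorb`, the restriction of `f` to `W` is isomorphic to `f × W`. -/
lemma ProdStable.res {S : MorphismProperty M} [Φ.ProdStable S] {X Y U W : M} (hU : Φ.mem U)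
    (hW : Φ.mem W) (a : W ⟶ U) (f : X ⨯ U ⟶ Y ⨯ U) (hf : S f) : S (res a f) := by
  have e : Arrow.mk (prod.map f (𝟙 W)) ≅ Arrow.mk (ModelFilter.res a f) :=
    Arrow.isoMk (absorb X hU hW a) (absorb Y hU hW a) (prod_hom_ext hW (by
      have : (prod.map (prod.fst : X ⨯ U ⟶ X) (𝟙 W) ≫ prod.map (𝟙 X) a : (X ⨯ U) ⨯ W ⟶ _) =
          prod.fst := prod_hom_ext hU (by simp)
      simp only [absorb_hom, Arrow.mk_left, Arrow.mk_right, Arrow.mk_hom,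
        Category.assoc, res_fst, reassoc_of% this, prod.map_fst, prod.map_fst_assoc]))
  exact (S.arrow_mk_iso_iff e).1 (ProdStable.prodMap hW f hf)

instance : Φ.ProdStable (⊤ : MorphismProperty M) where
  prodMap _ _ _ := trivial

instance (S T : MorphismProperty M) [Φ.ProdStable S] [Φ.ProdStable T] :
    Φ.ProdStable (S ⊓ T) where
  prodMap hU f hf := ⟨ProdStable.prodMap hU f hf.1, ProdStable.prodMap hU f hf.2⟩

instance : Φ.ProdStable (MorphismProperty.isomorphisms M) where
  prodMap _ f hf := by
    have : IsIso f := hf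
    exact inferInstanceAs (IsIso (prod.map f (𝟙 _)))

lemma quotientClass_iff {S : MorphismProperty M} {X Y : M} {φ : Φ.proj.obj X ⟶ Φ.proj.obj Y} :
    Φ.quotientClass S φ ↔
      ∃ (U : M) (hU : Φ.mem U) (f : X ⨯ U ⟶ Y ⨯ U), φ = stage hU f ∧ S f := by
  constructor
  · rintro ⟨U, hU, f, rfl, hf⟩
    exact ⟨U, hU, _, congrArg (QuotientCat.homMk hU) (prod.lift_fst _ _).symm, hf⟩
  · rintro ⟨U, hU, f, rfl, hf⟩
    refine ⟨U, hU, f ≫ prod.fst, rfl, ?_⟩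
    have : prod.lift (f ≫ prod.fst) prod.snd = f :=
      prod_hom_ext hU (prod.lift_fst _ _)
    change S (prod.lift (f ≫ prod.fst) prod.snd)
    rwa [this]

lemma quotientClass_stage {S : MorphismProperty M} {X Y U : M} (hU : Φ.mem U)
    {f : X ⨯ U ⟶ Y ⨯ U} (hf : S f) : Φ.quotientClass S (stage hU f) :=
  quotientClass_iff.2 ⟨U, hU, f, rfl, hf⟩

lemma quotientClass_proj_map {S : MorphismProperty M} [Φ.ProdStable S] {X Y : M} (f : X ⟶ Y)
    (hf : S f) : Φ.quotientClass S (Φ.proj.map f) := by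
  obtain ⟨U, hU⟩ := Φ.nonempty
  exact stage_prodMap hU f ▸ quotientClass_stage hU (ProdStable.prodMap hU f hf)

lemma quotientClass_top {X Y : M} (φ : Φ.proj.obj X ⟶ Φ.proj.obj Y) :
    Φ.quotientClass ⊤ φ :=
  let ⟨U, hU, f, h⟩ := exists_eq_stage φ
  quotientClass_iff.2 ⟨U, hU, f, h, trivial⟩

/-- Restrictions of a representative in `S` stay in `S`, so several morphisms can be given good
representatives at the same stage. -/
lemma quotientClass.eventually {S : MorphismProperty M} [Φ.ProdStable S] {X Y : M}
    {φ : Φ.proj.obj X ⟶ Φ.proj.obj Y} (hφ : Φ.quotientClass S φ) :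
    Φ.Eventually fun U =>
      ∃ f : X ⨯ U ⟶ Y ⨯ U, (∀ hU : Φ.mem U, φ = stage hU f) ∧ S f := by
  obtain ⟨U, hU, f, rfl, hf⟩ := quotientClass_iff.1 hφ
  exact ⟨U, hU, fun W hW a =>
    ⟨res a f, fun _ => (stage_res hU hW a f).symm, ProdStable.res hU hW a f hf⟩⟩

/-- The representatives in `S` and in `T` may differ, but they coincide after restriction to a
smaller stage, where both properties persist. -/
lemma quotientClass_inf (S T : MorphismProperty M) [Φ.ProdStable S] [Φ.ProdStable T] :
    Φ.quotientClass (S ⊓ T) = Φ.quotientClass S ⊓ Φ.quotientClass T := by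
  ext X Y φ
  constructor
  · rintro ⟨U, hU, f, h, hf⟩
    exact ⟨⟨U, hU, f, h, hf.1⟩, ⟨U, hU, f, h, hf.2⟩⟩
  · obtain ⟨X, rfl⟩ := exists_eq_proj_obj Φ X
    obtain ⟨Y, rfl⟩ := exists_eq_proj_obj Φ Y
    rintro ⟨hS, hT⟩
    obtain ⟨U, hU, ⟨f, hφ, hf⟩, g, hφ', hg⟩ := ((hS.eventually).and hT.eventually).exists
    obtain ⟨W, hW, h, ⟨a⟩⟩ := ((Eventually.res_eq ((hφ hU).symm.trans (hφ' hU))).and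
      (Eventually.of_le hU)).exists
    refine quotientClass_iff.2 ⟨W, hW, res a f, (hφ hU).trans (stage_res hU hW a f).symm,
      ProdStable.res hU hW a f hf, ?_⟩
    rw [h a]
    exact ProdStable.res hU hW a g hg

lemma isIso_of_quotientClass {X Y : M} {φ : Φ.proj.obj X ⟶ Φ.proj.obj Y}
    (h : Φ.quotientClass (MorphismProperty.isomorphisms M) φ) : IsIso φ := by
  obtain ⟨U, hU, f, rfl, hf⟩ := quotientClass_iff.1 h
  have : IsIso f := hf
  exact ⟨stage hU (inv f), by rw [stage_comp, IsIso.hom_inv_id, stage_id],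
    by rw [stage_comp, IsIso.inv_hom_id, stage_id]⟩

/-- Representatives of `φ` and of its inverse become mutually inverse once restricted far enough. -/
lemma quotientClass_of_isIso {X Y : M} (φ : Φ.proj.obj X ⟶ Φ.proj.obj Y) [IsIso φ] :
    Φ.quotientClass (MorphismProperty.isomorphisms M) φ := by
  obtain ⟨U, hU, ⟨f, hf, -⟩, g, hg, -⟩ := ((quotientClass_top φ).eventually.and
    (quotientClass_top (inv φ)).eventually).exists
  have h₁ : stage hU (f ≫ g) = stage hU (𝟙 _) := by
    rw [← stage_comp, ← hf hU, ← hg hU, stage_id, IsIso.hom_inv_id]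
  have h₂ : stage hU (g ≫ f) = stage hU (𝟙 _) := by
    rw [← stage_comp, ← hf hU, ← hg hU, stage_id, IsIso.inv_hom_id]
  obtain ⟨W, hW, ⟨h₁, h₂⟩, ⟨a⟩⟩ := (((Eventually.res_eq h₁).and (Eventually.res_eq h₂)).and
    (Eventually.of_le hU)).exists
  refine quotientClass_iff.2 ⟨W, hW, res a f, (hf hU).trans (stage_res hU hW a f).symm,
    ⟨res a g, ?_, ?_⟩⟩
  · rw [← res_comp hU hW, h₁ a, res_id hW]
  · rw [← res_comp hU hW, h₂ a, res_id hW]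

instance (S : MorphismProperty M) [Φ.ProdStable S] : (Φ.quotientClass S).RespectsIso := by
  apply MorphismProperty.RespectsIso.mk
  all_goals
    intro X Y Z e φ hφ
    obtain ⟨X, rfl⟩ := exists_eq_proj_obj Φ X
    obtain ⟨Y, rfl⟩ := exists_eq_proj_obj Φ Y
    obtain ⟨Z, rfl⟩ := exists_eq_proj_obj Φ Z
    obtain ⟨U, hU, ⟨g, hg, hgi⟩, f, hf, hfS⟩ :=
      ((quotientClass_of_isIso e.hom).eventually.and hφ.eventually).exists
    have : IsIso g := hgi
    rw [hg hU, hf hU, stage_comp]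
    refine quotientClass_stage hU ?_
  · exact MorphismProperty.RespectsIso.precomp S g f hfS
  · exact MorphismProperty.RespectsIso.postcomp S g f hfS

/-- The isomorphism `P_Φ (X × U) ≅ P_Φ X`. -/
def projFst (X : M) {U : M} (hU : Φ.mem U) : Φ.proj.obj (X ⨯ U) ≅ Φ.proj.obj X :=
  haveI : IsIso (Φ.proj.map (prod.fst : X ⨯ U ⟶ X)) := by
    rw [← stage_prodMap hU]
    -- At the stage `U` the projection becomes `absorb` with `W = U`.
    exact isIso_of_quotientClass (quotientClass_stage hU ((absorb X hU hU (𝟙 U)).isIso_hom))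
  asIso (Φ.proj.map prod.fst)

/-- This naturality reduces isomorphism-invariant statements about arrows of the quotient to arrows
in the image of `P_Φ`. -/
lemma proj_map_comp_projFst {X Y U : M} (hU : Φ.mem U) (f : X ⨯ U ⟶ Y ⨯ U) :
    Φ.proj.map f ≫ (projFst Y hU).hom = (projFst X hU).hom ≫ stage hU f := by
  dsimp [projFst]
  rw [← stage_prodMap hU, ← stage_prodMap hU, ← stage_prodMap hU, stage_comp, stage_comp]
  congr 1
  refine prod_hom_ext hU ?_
  have : (prod.map (prod.fst : X ⨯ U ⟶ X) (𝟙 U) : (X ⨯ U) ⨯ U ⟶ _) = prod.fst :=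
    prod_hom_ext hU (by simp)
  simp only [this, Category.assoc, prod.map_fst, prod.map_fst_assoc]

/-- Every morphism of the quotient at the stage `U` is isomorphic to the image of a morphism. -/
def stageIso {X Y U : M} (hU : Φ.mem U) (f : X ⨯ U ⟶ Y ⨯ U) :
    Arrow.mk (Φ.proj.map f) ≅ Arrow.mk (stage hU f) :=
  Arrow.isoMk (projFst X hU) (projFst Y hU) (proj_map_comp_projFst hU f).symm

/-! ### Finite limits and colimits in the quotient -/

/-- The morphism of the quotient represented by `f : X × U ⟶ Y`, between objects in the image of
the projection functor. -/
def cls {X Y U : M} (hU : Φ.mem U) (f : X ⨯ U ⟶ Y) : Φ.proj.obj X ⟶ Φ.proj.obj Y :=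
  QuotientCat.homMk hU f

lemma exists_eq_cls {X Y : M} (φ : Φ.proj.obj X ⟶ Φ.proj.obj Y) :
    ∃ (U : M) (hU : Φ.mem U) (f : X ⨯ U ⟶ Y), φ = cls hU f :=
  let ⟨U, hU, f, hf⟩ := exists_eq_stage φ
  ⟨U, hU, f ≫ prod.fst, hf⟩

lemma cls_restrict {X Y U W : M} (hU : Φ.mem U) (hW : Φ.mem W) (a : W ⟶ U) (f : X ⨯ U ⟶ Y) :
    cls hW (prod.map (𝟙 X) a ≫ f) = cls hU f :=
  (QuotientCat.homMk_eq_homMk_iff _ _ _ _).2 ⟨W, hW, 𝟙 W, a, by simp⟩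

/-- Two morphisms of the quotient have representatives over a common member of the filter. -/
lemma exists_eq_cls₂ {X X' Y Y' : M} (φ : Φ.proj.obj X ⟶ Φ.proj.obj Y)
    (ψ : Φ.proj.obj X' ⟶ Φ.proj.obj Y') :
    ∃ (U : M) (hU : Φ.mem U) (f : X ⨯ U ⟶ Y) (g : X' ⨯ U ⟶ Y'),
      φ = cls hU f ∧ ψ = cls hU g := by
  obtain ⟨U, hU, f, rfl⟩ := exists_eq_cls φ
  obtain ⟨U', hU', g, rfl⟩ := exists_eq_cls ψ
  obtain ⟨W, hW, ⟨a⟩, ⟨b⟩⟩ := Φ.directed hU hU'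
  exact ⟨W, hW, _, _, (cls_restrict hU hW a f).symm, (cls_restrict hU' hW b g).symm⟩

lemma Eventually.cls_eq {X Y U : M} {hU : Φ.mem U} {f g : X ⨯ U ⟶ Y}
    (h : cls hU f = cls hU g) :
    Φ.Eventually fun W => ∀ a : W ⟶ U, prod.map (𝟙 X) a ≫ f = prod.map (𝟙 X) a ≫ g := by
  obtain ⟨W, hW, a, b, h⟩ := (QuotientCat.homMk_eq_homMk_iff _ _ _ _).1 h
  refine ⟨W, hW, fun Z hZ c d => ?_⟩
  have := congr(prod.map (𝟙 X) c ≫ $h)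
  simp only [prod.map_map_assoc, Category.comp_id] at this
  rwa [hom_eq hU (c ≫ a) d, hom_eq hU (c ≫ b) d] at this

lemma cls_comp_proj_map {X Y Z U : M} (hU : Φ.mem U) (f : X ⨯ U ⟶ Y) (g : Y ⟶ Z) :
    cls hU f ≫ Φ.proj.map g = cls hU (f ≫ g) := by
  obtain ⟨W, hW, ⟨a⟩, ⟨b⟩⟩ := Φ.directed hU Φ.nonempty.choose_spec
  refine (QuotientCat.homMk_comp_homMk _ _ hW a b _ _).trans ?_
  rw [prod.lift_fst_assoc, Category.assoc]
  exact cls_restrict hU hW a (f ≫ g)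

lemma proj_map_comp_cls {X Y Z U : M} (hU : Φ.mem U) (f : X ⟶ Y) (g : Y ⨯ U ⟶ Z) :
    Φ.proj.map f ≫ cls hU g = cls hU (prod.map f (𝟙 U) ≫ g) := by
  obtain ⟨W, hW, ⟨a⟩, ⟨b⟩⟩ := Φ.directed Φ.nonempty.choose_spec hU
  have key : prod.lift (prod.map (𝟙 X) a ≫ prod.fst ≫ f) (prod.snd ≫ b) ≫ g =
      prod.map (𝟙 X) b ≫ prod.map f (𝟙 U) ≫ g := by
    rw [← Category.assoc _ _ g]
    congr 1
    exact prod_hom_ext hU (by simp)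
  refine (QuotientCat.homMk_comp_homMk _ _ hW a b _ _).trans (Eq.trans ?_
    (cls_restrict hU hW b (prod.map f (𝟙 U) ≫ g)))
  exact congrArg (cls hW) key

/-- Lifts in the quotient are built from representatives that are only known to exist, hence the
existential form of the universal property. -/
lemma _root_.CategoryTheory.IsPullback.of_exists_lift {C : Type*} [Category* C] {P X Y Z : C}
    {fst : P ⟶ X} {snd : P ⟶ Y} {f : X ⟶ Z} {g : Y ⟶ Z} (w : fst ≫ f = snd ≫ g)
    (lift : ∀ {T : C} (a : T ⟶ X) (b : T ⟶ Y), a ≫ f = b ≫ g →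
      ∃ l : T ⟶ P, l ≫ fst = a ∧ l ≫ snd = b)
    (ext : ∀ {T : C} (l l' : T ⟶ P), l ≫ fst = l' ≫ fst → l ≫ snd = l' ≫ snd → l = l') :
    IsPullback fst snd f g :=
  ⟨⟨w⟩, ⟨PullbackCone.IsLimit.mk w (fun s => (lift _ _ s.condition).choose)
    (fun s => (lift _ _ s.condition).choose_spec.1)
    (fun s => (lift _ _ s.condition).choose_spec.2)
    (fun s _ h h' => ext _ _ (h.trans (lift _ _ s.condition).choose_spec.1.symm)
      (h'.trans (lift _ _ s.condition).choose_spec.2.symm))⟩⟩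

lemma _root_.CategoryTheory.IsPushout.of_exists_desc {C : Type*} [Category* C] {P X Y Z : C}
    {f : Z ⟶ X} {g : Z ⟶ Y} {inl : X ⟶ P} {inr : Y ⟶ P} (w : f ≫ inl = g ≫ inr)
    (desc : ∀ {T : C} (a : X ⟶ T) (b : Y ⟶ T), f ≫ a = g ≫ b →
      ∃ l : P ⟶ T, inl ≫ l = a ∧ inr ≫ l = b)
    (ext : ∀ {T : C} (l l' : P ⟶ T), inl ≫ l = inl ≫ l' → inr ≫ l = inr ≫ l' → l = l') :
    IsPushout f g inl inr :=
  ⟨⟨w⟩, ⟨PushoutCocone.IsColimit.mk w (fun s => (desc _ _ s.condition).choose)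
    (fun s => (desc _ _ s.condition).choose_spec.1)
    (fun s => (desc _ _ s.condition).choose_spec.2)
    (fun s _ h h' => ext _ _ (h.trans (desc _ _ s.condition).choose_spec.1.symm)
      (h'.trans (desc _ _ s.condition).choose_spec.2.symm))⟩⟩

/-- The projection functor preserves pullback squares. -/
lemma isPullback_proj_map {P X Y Z : M} {fst : P ⟶ X} {snd : P ⟶ Y} {f : X ⟶ Z} {g : Y ⟶ Z}
    (h : IsPullback fst snd f g) :
    IsPullback (Φ.proj.map fst) (Φ.proj.map snd) (Φ.proj.map f) (Φ.proj.map g) := by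
  refine .of_exists_lift (by simp only [← Functor.map_comp, h.w]) ?_ ?_
  · intro T a b hab
    obtain ⟨T, rfl⟩ := exists_eq_proj_obj Φ T
    obtain ⟨U, hU, a, b, rfl, rfl⟩ := exists_eq_cls₂ a b
    rw [cls_comp_proj_map, cls_comp_proj_map] at hab
    -- On a small enough `W` the cone commutes in `M` with apex `T × W`, and the pullback in `M`
    -- supplies the lift.
    obtain ⟨W, hW, e, ⟨t⟩⟩ := ((Eventually.cls_eq hab).and (Eventually.of_le hU)).exists
    have e := e t
    simp only [← Category.assoc] at e
    refine ⟨cls hW (h.lift _ _ e), ?_, ?_⟩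
    · rw [cls_comp_proj_map, h.lift_fst]
      exact cls_restrict hU hW t a
    · rw [cls_comp_proj_map, h.lift_snd]
      exact cls_restrict hU hW t b
  · intro T l l' h₁ h₂
    obtain ⟨T, rfl⟩ := exists_eq_proj_obj Φ T
    obtain ⟨U, hU, l, l', rfl, rfl⟩ := exists_eq_cls₂ l l'
    rw [cls_comp_proj_map, cls_comp_proj_map] at h₁ h₂
    obtain ⟨W, hW, ⟨e₁, e₂⟩, ⟨t⟩⟩ := (((Eventually.cls_eq h₁).and (Eventually.cls_eq h₂)).and
      (Eventually.of_le hU)).exists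
    rw [← cls_restrict hU hW t l, ← cls_restrict hU hW t l']
    congr 1
    exact h.hom_ext (by simpa using e₁ t) (by simpa using e₂ t)

lemma isPushout_prodMap {U : M} [PreservesColimitsOfShape WalkingSpan (prod.functor.obj U)]
    {P X Y Z : M} {f : Z ⟶ X} {g : Z ⟶ Y} {inl : X ⟶ P} {inr : Y ⟶ P}
    (h : IsPushout f g inl inr) :
    IsPushout (prod.map f (𝟙 U)) (prod.map g (𝟙 U)) (prod.map inl (𝟙 U))
      (prod.map inr (𝟙 U)) := by
  have h' := h.map (prod.functor.obj U)
  -- `prod.functor.obj U` multiplies by `U` on the left, while representatives carry it on the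
  -- right.
  refine h'.of_iso (prod.braiding _ _) (prod.braiding _ _) (prod.braiding _ _)
    (prod.braiding _ _) ?_ ?_ ?_ ?_
  all_goals simp [prod.functor]

/-- The projection functor preserves pushout squares. -/
lemma isPushout_proj_map
    (hΦ : ∀ U : M, Φ.mem U → PreservesColimitsOfShape WalkingSpan (prod.functor.obj U))
    {P X Y Z : M} {f : Z ⟶ X} {g : Z ⟶ Y} {inl : X ⟶ P} {inr : Y ⟶ P}
    (h : IsPushout f g inl inr) :
    IsPushout (Φ.proj.map f) (Φ.proj.map g) (Φ.proj.map inl) (Φ.proj.map inr) := by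
  refine .of_exists_desc (by simp only [← Functor.map_comp, h.w]) ?_ ?_
  · intro T a b hab
    obtain ⟨T, rfl⟩ := exists_eq_proj_obj Φ T
    obtain ⟨U, hU, a, b, rfl, rfl⟩ := exists_eq_cls₂ a b
    rw [proj_map_comp_cls, proj_map_comp_cls] at hab
    obtain ⟨W, hW, e, ⟨t⟩⟩ := ((Eventually.cls_eq hab).and (Eventually.of_le hU)).exists
    -- A cocone in the quotient is represented by a cocone under the square multiplied by `W`, which
    -- is still a pushout.
    have := hΦ W hW
    have h' := isPushout_prodMap (U := W) h
    have e : prod.map f (𝟙 W) ≫ prod.map (𝟙 X) t ≫ a =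
        prod.map g (𝟙 W) ≫ prod.map (𝟙 Y) t ≫ b := by
      simpa using e t
    refine ⟨cls hW (h'.desc _ _ e), ?_, ?_⟩
    · rw [proj_map_comp_cls, h'.inl_desc]
      exact cls_restrict hU hW t a
    · rw [proj_map_comp_cls, h'.inr_desc]
      exact cls_restrict hU hW t b
  · intro T l l' h₁ h₂
    obtain ⟨T, rfl⟩ := exists_eq_proj_obj Φ T
    obtain ⟨U, hU, l, l', rfl, rfl⟩ := exists_eq_cls₂ l l'
    rw [proj_map_comp_cls, proj_map_comp_cls] at h₁ h₂
    obtain ⟨W, hW, ⟨e₁, e₂⟩, ⟨t⟩⟩ := (((Eventually.cls_eq h₁).and (Eventually.cls_eq h₂)).and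
      (Eventually.of_le hU)).exists
    rw [← cls_restrict hU hW t l, ← cls_restrict hU hW t l']
    congr 1
    have := hΦ W hW
    exact (isPushout_prodMap (U := W) h).hom_ext (by simpa using e₁ t) (by simpa using e₂ t)

/-- Two morphisms of the quotient have representatives at a common stage. -/
lemma exists_eq_stage₂ {X X' Y Y' : M} (φ : Φ.proj.obj X ⟶ Φ.proj.obj Y)
    (ψ : Φ.proj.obj X' ⟶ Φ.proj.obj Y') :
    ∃ (U : M) (hU : Φ.mem U) (f : X ⨯ U ⟶ Y ⨯ U) (g : X' ⨯ U ⟶ Y' ⨯ U),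
      φ = stage hU f ∧ ψ = stage hU g :=
  let ⟨U, hU, ⟨f, hf, _⟩, ⟨g, hg, _⟩⟩ :=
    ((quotientClass_top φ).eventually.and (quotientClass_top ψ).eventually).exists
  ⟨U, hU, f, g, hf hU, hg hU⟩

variable (Φ) in
-- A cospan represented at a stage is isomorphic, through `projFst`, to the image of a cospan of
-- `M`.
lemma hasPullbacks_quotientCat : HasPullbacks Φ.QuotientCat := by
  suffices ∀ {X Y Z : Φ.QuotientCat} {f : X ⟶ Z} {g : Y ⟶ Z}, HasLimit (cospan f g) from
    hasPullbacks_of_hasLimit_cospan _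
  intro X Y Z f g
  obtain ⟨X, rfl⟩ := exists_eq_proj_obj Φ X
  obtain ⟨Y, rfl⟩ := exists_eq_proj_obj Φ Y
  obtain ⟨Z, rfl⟩ := exists_eq_proj_obj Φ Z
  obtain ⟨U, hU, f, g, rfl, rfl⟩ := exists_eq_stage₂ f g
  have : HasLimit (cospan (Φ.proj.map f) (Φ.proj.map g)) :=
    (isPullback_proj_map (IsPullback.of_hasPullback f g)).hasPullback
  exact hasLimit_of_iso (cospanExt (projFst X hU) (projFst Y hU) (projFst Z hU)
    (proj_map_comp_projFst hU f).symm (proj_map_comp_projFst hU g).symm)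

lemma hasPushouts_quotientCat
    (hΦ : ∀ U : M, Φ.mem U → PreservesColimitsOfShape WalkingSpan (prod.functor.obj U)) :
    HasPushouts Φ.QuotientCat := by
  suffices ∀ {X Y Z : Φ.QuotientCat} {f : Z ⟶ X} {g : Z ⟶ Y}, HasColimit (span f g) from
    hasPushouts_of_hasColimit_span _
  intro X Y Z f g
  obtain ⟨X, rfl⟩ := exists_eq_proj_obj Φ X
  obtain ⟨Y, rfl⟩ := exists_eq_proj_obj Φ Y
  obtain ⟨Z, rfl⟩ := exists_eq_proj_obj Φ Z
  obtain ⟨U, hU, f, g, rfl, rfl⟩ := exists_eq_stage₂ f g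
  have : HasColimit (span (Φ.proj.map f) (Φ.proj.map g)) :=
    (isPushout_proj_map hΦ (IsPushout.of_hasPushout f g)).hasPushout
  exact hasColimit_of_iso (spanExt (projFst Z hU) (projFst X hU) (projFst Y hU)
    (proj_map_comp_projFst hU f).symm (proj_map_comp_projFst hU g).symm).symm

variable (Φ) in
lemma hasTerminal_quotientCat : HasTerminal Φ.QuotientCat := by
  refine IsTerminal.hasTerminal (X := Φ.proj.obj (⊤_ M)) (IsTerminal.ofUniqueHom
    (fun X => Φ.proj.map (terminal.from X.base)) fun X m => ?_)
  obtain ⟨X, rfl⟩ := exists_eq_proj_obj Φ X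
  obtain ⟨U, hU, f, g, rfl, h⟩ := exists_eq_cls₂ m (Φ.proj.map (terminal.from X))
  refine Eq.trans ?_ h.symm
  congr 1
  exact Subsingleton.elim _ _

variable (Φ) in
lemma hasInitial_quotientCat : HasInitial Φ.QuotientCat := by
  refine IsInitial.hasInitial (X := Φ.proj.obj (⊥_ M)) (IsInitial.ofUniqueHom
    (fun X => Φ.proj.map (initial.to X.base)) fun X m => ?_)
  obtain ⟨X, rfl⟩ := exists_eq_proj_obj Φ X
  obtain ⟨U, hU, f, g, rfl, h⟩ := exists_eq_cls₂ m (Φ.proj.map (initial.to X))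
  refine Eq.trans ?_ h.symm
  congr 1
  -- The product with `U` preserves the initial object automatically: `⊥` maps to `U`, and `U` is
  -- subterminal.
  let e : (⊥_ M) ⨯ U ≅ ⊥_ M :=
    { hom := prod.fst
      inv := prod.lift (𝟙 _) (initial.to U)
      hom_inv_id := prod_hom_ext hU (by simp [prod.lift_fst]) }
  exact (e.cancel_iso_inv_left _ _).1 (Subsingleton.elim _ _)

/-! ### The model structure on the quotient -/

instance : Φ.ProdStable (cofibrations M) where
  prodMap hU f hf := (Φ.cofibration_prod f ⟨hf⟩ hU).mem

instance : Φ.ProdStable (weakEquivalences M) where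
  prodMap hU f hf := (Φ.weakEquivalence_prod f ⟨hf⟩ hU).mem

/-- Since `f × U` is a base change of `f`, stability of fibrations need not be part of the
definition of a model filter. -/
lemma isPullback_prodMap_fst {X Y : M} (f : X ⟶ Y) (U : M) :
    IsPullback (prod.fst : X ⨯ U ⟶ X) (prod.map f (𝟙 U)) f (prod.fst : Y ⨯ U ⟶ Y) :=
  .of_exists_lift (by simp)
    (fun a b h => ⟨prod.lift a (b ≫ prod.snd), prod.lift_fst _ _, by
      apply Limits.prod.hom_ext <;> simp [prod.lift_fst, prod.lift_snd, h]⟩)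
    (fun l l' h h' => Limits.prod.hom_ext h (by simpa using congr($h' ≫ prod.snd)))

instance : Φ.ProdStable (fibrations M) where
  prodMap {_ _ U} _ f hf := MorphismProperty.of_isPullback (isPullback_prodMap_fst f U) hf

/-- A square of the quotient category between morphisms in `S_Φ` and `T_Φ` has a lift. -/
lemma hasLiftingProperty_quotientClass {S T : MorphismProperty M} [Φ.ProdStable S]
    [Φ.ProdStable T]
    (h : ∀ {A B X Y : M} (i : A ⟶ B) (p : X ⟶ Y), S i → T p → HasLiftingProperty i p)
    {A B X Y : Φ.QuotientCat} (i : A ⟶ B) (p : X ⟶ Y) (hi : Φ.quotientClass S i)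
    (hp : Φ.quotientClass T p) : HasLiftingProperty i p := by
  obtain ⟨A, rfl⟩ := exists_eq_proj_obj Φ A
  obtain ⟨B, rfl⟩ := exists_eq_proj_obj Φ B
  obtain ⟨X, rfl⟩ := exists_eq_proj_obj Φ X
  obtain ⟨Y, rfl⟩ := exists_eq_proj_obj Φ Y
  refine ⟨fun {a b} sq => ?_⟩
  obtain ⟨U, hU, ⟨⟨i, hi, hiS⟩, p, hp, hpT⟩, ⟨a, ha, -⟩, b, hb, -⟩ :=
    ((hi.eventually.and hp.eventually).and
      ((quotientClass_top a).eventually.and (quotientClass_top b).eventually)).exists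
  obtain rfl := hi hU
  obtain rfl := hp hU
  obtain rfl := ha hU
  obtain rfl := hb hU
  have w := sq.w
  rw [stage_comp, stage_comp] at w
  -- The representing square commutes in `M` only after restriction; the lift is found there.
  obtain ⟨W, hW, w, ⟨t⟩⟩ := ((Eventually.res_eq w).and (Eventually.of_le hU)).exists
  have w := w t
  rw [res_comp hU hW, res_comp hU hW] at w
  have := h _ _ (ProdStable.res hU hW t i hiS) (ProdStable.res hU hW t p hpT)
  have sq' : CommSq (res t a) (res t i) (res t p) (res t b) := ⟨w⟩
  exact ⟨⟨⟨stage hW sq'.lift,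
    by rw [← stage_res hU hW t i, stage_comp, sq'.fac_left, stage_res hU],
    by rw [← stage_res hU hW t p, stage_comp, sq'.fac_right, stage_res hU]⟩⟩⟩

/-- A representative `X × U ⟶ Y × U` is factored in `M`, and the image of this factorization is
corrected by the isomorphisms `projFst`. -/
lemma hasFactorization_quotientClass {S T : MorphismProperty M} [Φ.ProdStable S]
    [Φ.ProdStable T] [S.HasFactorization T] :
    (Φ.quotientClass S).HasFactorization (Φ.quotientClass T) where
  nonempty_mapFactorizationData {X Y} φ := by
    obtain ⟨X, rfl⟩ := exists_eq_proj_obj Φ X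
    obtain ⟨Y, rfl⟩ := exists_eq_proj_obj Φ Y
    obtain ⟨U, hU, f, rfl⟩ := exists_eq_stage φ
    let d := S.factorizationData T f
    exact ⟨{
      Z := Φ.proj.obj d.Z
      i := (projFst X hU).inv ≫ Φ.proj.map d.i
      p := Φ.proj.map d.p ≫ (projFst Y hU).hom
      hi := MorphismProperty.RespectsIso.precomp _ _ _ (quotientClass_proj_map _ d.hi)
      hp := MorphismProperty.RespectsIso.postcomp _ _ _ (quotientClass_proj_map _ d.hp)
      fac := by
        rw [Category.assoc, ← Functor.map_comp_assoc, d.fac, proj_map_comp_projFst,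
          Iso.inv_hom_id_assoc] }⟩

/-- A retract diagram consists of six morphisms and four equations, so it is realised in `M` at a
single stage. -/
lemma isStableUnderRetracts_quotientClass {S : MorphismProperty M} [Φ.ProdStable S]
    [S.IsStableUnderRetracts] : (Φ.quotientClass S).IsStableUnderRetracts where
  of_retract {X Y Z W f g} h hg := by
    obtain ⟨X, rfl⟩ := exists_eq_proj_obj Φ X
    obtain ⟨Y, rfl⟩ := exists_eq_proj_obj Φ Y
    obtain ⟨Z, rfl⟩ := exists_eq_proj_obj Φ Z
    obtain ⟨W, rfl⟩ := exists_eq_proj_obj Φ W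
    have e₁ : h.i.left ≫ g = f ≫ h.i.right := h.i_w
    have e₂ : h.r.left ≫ f = g ≫ h.r.right := h.r_w
    have e₃ : h.i.left ≫ h.r.left = 𝟙 _ := h.left.retract
    have e₄ : h.i.right ≫ h.r.right = 𝟙 _ := h.right.retract
    generalize h.i.left = a at *
    generalize h.i.right = b at *
    generalize h.r.left = c at *
    generalize h.r.right = d at *
    dsimp at a b c d
    obtain ⟨U, hU, ⟨⟨⟨f, hf, -⟩, g, hg, hgS⟩, ⟨a, ha, -⟩, b, hb, -⟩, ⟨c, hc, -⟩, d, hd, -⟩ :=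
      ((((quotientClass_top f).eventually.and hg.eventually).and
        ((quotientClass_top a).eventually.and (quotientClass_top b).eventually)).and
        ((quotientClass_top c).eventually.and (quotientClass_top d).eventually)).exists
    obtain rfl := hf hU
    obtain rfl := hg hU
    obtain rfl := ha hU
    obtain rfl := hb hU
    obtain rfl := hc hU
    obtain rfl := hd hU
    rw [stage_comp, stage_comp] at e₁ e₂
    replace e₃ : stage hU (a ≫ c) = stage hU (𝟙 _) := by
      rw [← stage_comp, stage_id]
      exact e₃
    replace e₄ : stage hU (b ≫ d) = stage hU (𝟙 _) := by
      rw [← stage_comp, stage_id]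
      exact e₄
    obtain ⟨V, hV, ⟨⟨e₁, e₂⟩, e₃, e₄⟩, ⟨t⟩⟩ :=
      ((((Eventually.res_eq e₁).and (Eventually.res_eq e₂)).and
        ((Eventually.res_eq e₃).and (Eventually.res_eq e₄))).and (Eventually.of_le hU)).exists
    have e₁ := e₁ t
    have e₂ := e₂ t
    have e₃ := e₃ t
    have e₄ := e₄ t
    rw [res_comp hU hV, res_comp hU hV] at e₁ e₂
    rw [res_comp hU hV, res_id hV] at e₃ e₄
    rw [← stage_res hU hV t f]
    refine quotientClass_stage hV (S.of_retract (g := res t g)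
      { i := Arrow.homMk (res t a) (res t b) e₁
        r := Arrow.homMk (res t c) (res t d) e₂
        retract := ?_ } (ProdStable.res hU hV t g hgS))
    ext
    · exact e₃
    · exact e₄

lemma hasTwoOutOfThreeProperty_quotientClass {S : MorphismProperty M} [Φ.ProdStable S]
    [S.HasTwoOutOfThreeProperty] : (Φ.quotientClass S).HasTwoOutOfThreeProperty := by
  -- The three cases differ only in which of `f`, `g`, `f ≫ g` are known to lie in `S`. They are
  -- treated together by letting `P`, `Q`, `R` be `S` or `⊤`.
  suffices key : ∀ {X Y Z : Φ.QuotientCat} (f : X ⟶ Y) (g : Y ⟶ Z)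
      (P Q R : MorphismProperty M) [Φ.ProdStable P] [Φ.ProdStable Q] [Φ.ProdStable R]
      (_ : Φ.quotientClass P f) (_ : Φ.quotientClass Q g) (_ : Φ.quotientClass R (f ≫ g)),
      ∃ (A B C U : M) (hU : Φ.mem U) (f' : A ⨯ U ⟶ B ⨯ U) (g' : B ⨯ U ⟶ C ⨯ U),
        P f' ∧ Q g' ∧ R (f' ≫ g') ∧ (S f' → Φ.quotientClass S f) ∧
          (S g' → Φ.quotientClass S g) ∧ (S (f' ≫ g') → Φ.quotientClass S (f ≫ g)) by
    have top {X Y : Φ.QuotientCat} (f : X ⟶ Y) : Φ.quotientClass ⊤ f := quotientClass_top f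
    refine { comp_mem := ?_, of_postcomp := ?_, of_precomp := ?_ }
    · intro X Y Z f g hf hg
      obtain ⟨_, _, _, _, _, f', g', hf', hg', -, -, -, h⟩ := key f g S S ⊤ hf hg (top _)
      exact h (S.comp_mem _ _ hf' hg')
    · intro X Y Z f g hg hfg
      obtain ⟨_, _, _, _, _, f', g', -, hg', hfg', h, -, -⟩ := key f g ⊤ S S (top _) hg hfg
      exact h (S.of_postcomp _ _ hg' hfg')
    · intro X Y Z f g hf hfg
      obtain ⟨_, _, _, _, _, f', g', hf', -, hfg', -, h, -⟩ := key f g S ⊤ S hf (top _) hfg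
      exact h (S.of_precomp _ _ hf' hfg')
  intro X Y Z f g P Q R _ _ _ hf hg hfg
  obtain ⟨X, rfl⟩ := exists_eq_proj_obj Φ X
  obtain ⟨Y, rfl⟩ := exists_eq_proj_obj Φ Y
  obtain ⟨Z, rfl⟩ := exists_eq_proj_obj Φ Z
  obtain ⟨U, hU, ⟨⟨f, hf, hfP⟩, g, hg, hgQ⟩, k, hk, hkR⟩ :=
    ((hf.eventually.and hg.eventually).and hfg.eventually).exists
  obtain rfl := hf hU
  obtain rfl := hg hU
  have e := hk hU
  rw [stage_comp] at e
  obtain ⟨W, hW, e, ⟨t⟩⟩ := ((Eventually.res_eq e).and (Eventually.of_le hU)).exists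
  have e := e t
  refine ⟨X, Y, Z, W, hW, res t f, res t g, ProdStable.res hU hW t f hfP,
    ProdStable.res hU hW t g hgQ, ?_, fun h => ?_, fun h => ?_, fun h => ?_⟩
  · rw [← res_comp hU hW, e]
    exact ProdStable.res hU hW t k hkR
  · exact stage_res hU hW t f ▸ quotientClass_stage hW h
  · exact stage_res hU hW t g ▸ quotientClass_stage hW h
  · rw [← stage_res hU hW t f, ← stage_res hU hW t g, stage_comp]
    exact quotientClass_stage hW h

/-- The model structure on the filter quotient. -/
abbrev modelCategoryQuotientCat
    (hΦ : ∀ U : M, Φ.mem U → PreservesColimitsOfShape WalkingSpan (prod.functor.obj U)) :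
    ModelCategory Φ.QuotientCat :=
  letI : CategoryWithFibrations Φ.QuotientCat := ⟨Φ.quotientClass (fibrations M)⟩
  letI : CategoryWithCofibrations Φ.QuotientCat := ⟨Φ.quotientClass (cofibrations M)⟩
  letI : CategoryWithWeakEquivalences Φ.QuotientCat := ⟨Φ.quotientClass (weakEquivalences M)⟩
  have hF : trivialFibrations Φ.QuotientCat = Φ.quotientClass (trivialFibrations M) :=
    (quotientClass_inf _ _).symm
  have hC : trivialCofibrations Φ.QuotientCat = Φ.quotientClass (trivialCofibrations M) :=
    (quotientClass_inf _ _).symm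
  haveI : Φ.ProdStable (trivialFibrations M) :=
    inferInstanceAs (Φ.ProdStable (fibrations M ⊓ weakEquivalences M))
  haveI : Φ.ProdStable (trivialCofibrations M) :=
    inferInstanceAs (Φ.ProdStable (cofibrations M ⊓ weakEquivalences M))
  { categoryWithFibrations := inferInstance
    categoryWithCofibrations := inferInstance
    categoryWithWeakEquivalences := inferInstance
    cm1a := by
      have := hasTerminal_quotientCat Φ
      have := hasPullbacks_quotientCat Φ
      exact hasFiniteLimits_of_hasTerminal_and_pullbacks
    cm1b := by
      have := hasInitial_quotientCat Φ
      have := hasPushouts_quotientCat hΦ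
      exact hasFiniteColimits_of_hasInitial_and_pushouts
    cm2 := hasTwoOutOfThreeProperty_quotientClass (S := weakEquivalences M)
    cm3a := isStableUnderRetracts_quotientClass (S := weakEquivalences M)
    cm3b := isStableUnderRetracts_quotientClass (S := fibrations M)
    cm3c := isStableUnderRetracts_quotientClass (S := cofibrations M)
    cm4a i p hi hi' hp :=
      hasLiftingProperty_quotientClass (S := trivialCofibrations M) (T := fibrations M)
        (fun i p hi hp => by
          have : Cofibration i := ⟨hi.1⟩
          have : WeakEquivalence i := ⟨hi.2⟩
          have : Fibration p := ⟨hp⟩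
          infer_instance) i p (hC ▸ ⟨hi.mem, hi'.mem⟩) hp.mem
    cm4b i p hi hp hp' :=
      hasLiftingProperty_quotientClass (S := cofibrations M) (T := trivialFibrations M)
        (fun i p hi hp => by
          have : Cofibration i := ⟨hi⟩
          have : Fibration p := ⟨hp.1⟩
          have : WeakEquivalence p := ⟨hp.2⟩
          infer_instance) i p hi.mem (hF ▸ ⟨hp.mem, hp'.mem⟩)
    cm5a := by
      rw [hC]
      exact hasFactorization_quotientClass (T := fibrations M)
    cm5b := by
      rw [hF]
      exact hasFactorization_quotientClass (S := cofibrations M) }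

end ModelFilter

/-! ### Whiskering in enriched ordinary categories -/

section Whiskering

variable (V : Type u') [Category.{v'} V] [MonoidalCategory V] {C : Type u} [Category.{v} C]
  [EnrichedOrdinaryCategory V C]

lemma eHomEquiv_eHomWhiskerLeft {X Y Z : C} (f : X ⟶ Y) (g : Y ⟶ Z) :
    eHomEquiv V f ≫ eHomWhiskerLeft V X g = eHomEquiv V (f ≫ g) := by
  rw [eHomWhiskerLeft, eHomEquiv_comp, rightUnitor_inv_naturality_assoc, tensorHom_def_assoc,
    unitors_inv_equal]

lemma eHomEquiv_eHomWhiskerRight {X Y Z : C} (f : X ⟶ Y) (g : Y ⟶ Z) :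
    eHomEquiv V g ≫ eHomWhiskerRight V f Z = eHomEquiv V (f ≫ g) := by
  rw [eHomWhiskerRight, eHomEquiv_comp, leftUnitor_inv_naturality_assoc, tensorHom_def'_assoc]

/-- The enriched composition is extranatural in the middle variable. -/
lemma eHomWhiskerLeft_whiskerRight_eComp (X : C) {Y Y' : C} (f : Y ⟶ Y') (Z : C) :
    eHomWhiskerLeft V X f ▷ (Y' ⟶[V] Z) ≫ eComp V X Y' Z =
      (X ⟶[V] Y) ◁ eHomWhiskerRight V f Z ≫ eComp V X Y Z := by
  dsimp [eHomWhiskerLeft, eHomWhiskerRight]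
  simp only [MonoidalCategory.whiskerLeft_comp_assoc, whisker_assoc_symm,
    triangle_assoc_comp_left_inv_assoc, e_assoc', Category.assoc, comp_whiskerRight_assoc]

end Whiskering

namespace ModelFilter

variable {M : Type u} [Category.{v} M] [ModelCategory M] (Φ : ModelFilter M)

/-! ### The filter as a filtered index category. -/

instance : IsFiltered (Φ.mem.FullSubcategory)ᵒᵖ where
  cocone_objs U W :=
    let ⟨Z, hZ, ⟨a⟩, ⟨b⟩⟩ := Φ.directed U.unop.property W.unop.property
    ⟨op ⟨Z, hZ⟩, Quiver.Hom.op ⟨a⟩, Quiver.Hom.op ⟨b⟩, trivial⟩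
  cocone_maps {U W} f g := ⟨W, 𝟙 _, by
    congr 1
    apply Quiver.Hom.unop_inj
    ext
    exact hom_eq U.unop.property _ _⟩
  nonempty := let ⟨U, hU⟩ := Φ.nonempty; ⟨op ⟨U, hU⟩⟩

/-- Siftedness lets a tensor product of two colimits along the filter be computed as one colimit of
stagewise tensor products. -/
instance : IsSifted (Φ.mem.FullSubcategory)ᵒᵖ := IsFiltered.isSifted

/-! ### The transition maps of the diagram of mapping objects -/

section

variable {Φ} (V : Type u') [Category.{v'} V] [MonoidalCategory V]
  [EnrichedOrdinaryCategory V M] [Φ.HasEnrichedProducts V]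

/-- The assumption concerns sources `X × U`, but any `Z` that maps to `U` is isomorphic to `Z × U`.
The extra generality is needed for `Z = X × W` with `W ≤ U`. -/
lemma isIso_eHomWhiskerLeft_fst {Z : M} (Y : M) (U : Φ.mem.FullSubcategory) (z : Z ⟶ U.obj) :
    IsIso (eHomWhiskerLeft V Z (prod.fst : Y ⨯ U.obj ⟶ Y)) := by
  let e : Z ≅ Z ⨯ U.obj :=
    { hom := prod.lift (𝟙 Z) z
      inv := prod.fst
      hom_inv_id := prod.lift_fst _ _
      inv_hom_id := prod_hom_ext U.property (by simp [prod.lift_fst]) }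
  have h := eHom_whisker_exchange V e.hom (prod.fst : Y ⨯ U.obj ⟶ Y)
  have (T : M) : IsIso (eHomWhiskerRight V e.hom T) :=
    ⟨eHomWhiskerRight V e.inv T, by simp [← eHomWhiskerRight_comp],
      by simp [← eHomWhiskerRight_comp]⟩
  have : IsIso (eHomWhiskerRight V e.hom (Y ⨯ U.obj) ≫
      eHomWhiskerLeft V Z (prod.fst : Y ⨯ U.obj ⟶ Y)) := by
    rw [← h]
    infer_instance
  exact IsIso.of_isIso_comp_left (eHomWhiskerRight V e.hom (Y ⨯ U.obj)) _

variable (X Y Z : M) {U W : Φ.mem.FullSubcategory}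

/-- The transition map `Map(X × U, Y × U) ⟶ Map(X × W, Y × W)` for `W ≤ U`. -/
def trans (h : W ⟶ U) : ((X ⨯ U.obj) ⟶[V] (Y ⨯ U.obj)) ⟶ ((X ⨯ W.obj) ⟶[V] (Y ⨯ W.obj)) :=
  (Φ.mapDiagram V X Y).map h.op

lemma trans_fst (h : W ⟶ U) :
    trans V X Y h ≫ eHomWhiskerLeft V (X ⨯ W.obj) (prod.fst : Y ⨯ W.obj ⟶ Y) =
      eHomWhiskerLeft V (X ⨯ U.obj) (prod.fst : Y ⨯ U.obj ⟶ Y) ≫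
        eHomWhiskerRight V (prod.map (𝟙 X) h.hom) Y := by
  simp [trans, mapDiagram]

variable {Y Z} in
-- The enriched analogue of `prod_hom_ext`.
lemma eHom_ext_fst {K : V} (z : Z ⟶ U.obj) {f g : K ⟶ (Z ⟶[V] (Y ⨯ U.obj))}
    (h : f ≫ eHomWhiskerLeft V Z prod.fst = g ≫ eHomWhiskerLeft V Z prod.fst) : f = g := by
  have := isIso_eHomWhiskerLeft_fst V Y U z
  exact (cancel_mono _).1 h

variable {X Y Z} in
lemma eHom_ext_prodMap (h : W ⟶ U) {K : V}
    {f g : K ⟶ ((X ⨯ W.obj) ⟶[V] (Y ⨯ W.obj))}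
    (e : f ≫ eHomWhiskerLeft V (X ⨯ W.obj) (prod.map (𝟙 Y) h.hom) =
      g ≫ eHomWhiskerLeft V (X ⨯ W.obj) (prod.map (𝟙 Y) h.hom)) : f = g := by
  refine eHom_ext_fst V prod.snd ?_
  have := congr($e ≫ eHomWhiskerLeft V _ prod.fst)
  simpa [← eHomWhiskerLeft_comp] using this

/-- The enriched form of `res_map`. With `eHom_ext_prodMap` it characterises the transition maps by
an equation free of inverses, from which their compatibilities follow. -/
lemma trans_prodMap (h : W ⟶ U) :
    trans V X Y h ≫ eHomWhiskerLeft V (X ⨯ W.obj) (prod.map (𝟙 Y) h.hom) =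
      eHomWhiskerRight V (prod.map (𝟙 X) h.hom) (Y ⨯ U.obj) := by
  refine eHom_ext_fst V (prod.snd ≫ h.hom) ?_
  rw [Category.assoc, ← eHomWhiskerLeft_comp, prod.map_fst, Category.comp_id, trans_fst,
    eHom_whisker_exchange]

/-- The transition maps are compatible with the composition. -/
lemma eComp_trans (h : W ⟶ U) :
    eComp V (X ⨯ U.obj) (Y ⨯ U.obj) (Z ⨯ U.obj) ≫ trans V X Z h =
      (trans V X Y h ⊗ₘ trans V Y Z h) ≫
        eComp V (X ⨯ W.obj) (Y ⨯ W.obj) (Z ⨯ W.obj) := by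
  refine eHom_ext_prodMap V h ?_
  -- Both sides become composition at `U` followed by restriction in the source; extranaturality
  -- moves the middle object from `W` to `U`.
  rw [Category.assoc, Category.assoc, trans_prodMap, eComp_eHomWhiskerLeft,
    eComp_eHomWhiskerRight, tensorHom_def_assoc, ← MonoidalCategory.whiskerLeft_comp_assoc,
    trans_prodMap, ← eHomWhiskerLeft_whiskerRight_eComp, ← comp_whiskerRight_assoc,
    trans_prodMap]

variable {X Y} in
lemma eHomEquiv_trans (h : W ⟶ U) (f : X ⨯ U.obj ⟶ Y ⨯ U.obj) :
    eHomEquiv V f ≫ trans V X Y h = eHomEquiv V (res h.hom f) := by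
  refine eHom_ext_prodMap V h ?_
  rw [Category.assoc, trans_prodMap, eHomEquiv_eHomWhiskerRight, eHomEquiv_eHomWhiskerLeft,
    res_map U.property]

variable {Y Z} in
lemma eHomWhiskerLeft_trans (h : W ⟶ U) (f : Y ⨯ U.obj ⟶ Z ⨯ U.obj) :
    eHomWhiskerLeft V (X ⨯ U.obj) f ≫ trans V X Z h =
      trans V X Y h ≫ eHomWhiskerLeft V (X ⨯ W.obj) (res h.hom f) := by
  refine eHom_ext_prodMap V h ?_
  rw [Category.assoc, Category.assoc, trans_prodMap, ← eHomWhiskerLeft_comp,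
    res_map U.property, eHomWhiskerLeft_comp, reassoc_of% trans_prodMap, eHom_whisker_exchange]

variable {X Y} in
lemma eHomWhiskerRight_trans (h : W ⟶ U) (f : X ⨯ U.obj ⟶ Y ⨯ U.obj) :
    eHomWhiskerRight V f (Z ⨯ U.obj) ≫ trans V X Z h =
      trans V Y Z h ≫ eHomWhiskerRight V (res h.hom f) (Z ⨯ W.obj) := by
  refine eHom_ext_prodMap V h ?_
  rw [Category.assoc, Category.assoc, trans_prodMap, ← eHom_whisker_exchange,
    reassoc_of% trans_prodMap, ← eHomWhiskerRight_comp, ← eHomWhiskerRight_comp,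
    res_map U.property]

lemma prodMap_fst (U : Φ.mem.FullSubcategory) :
    Φ.prodMap V X Y U ≫ eHomWhiskerLeft V (X ⨯ U.obj) (prod.fst : Y ⨯ U.obj ⟶ Y) =
      eHomWhiskerRight V (prod.fst : X ⨯ U.obj ⟶ X) Y := by
  simp [prodMap]

lemma prodMap_trans (h : W ⟶ U) :
    Φ.prodMap V X Y U ≫ trans V X Y h = Φ.prodMap V X Y W := by
  refine eHom_ext_fst V prod.snd ?_
  rw [Category.assoc, trans_fst, reassoc_of% prodMap_fst, prodMap_fst, ← eHomWhiskerRight_comp,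
    prod.map_fst, Category.comp_id]

end

/-! ### Colimits along the filter -/

/-- The compatibilities of a monoidal category with colimits along the filter. -/
class HasFilterColimits (V : Type u') [Category.{v'} V] [MonoidalCategory V] : Prop where
  hasColimitsOfShape : HasColimitsOfShape (Φ.mem.FullSubcategory)ᵒᵖ V
  preserves_tensorLeft (X : V) :
    PreservesColimitsOfShape (Φ.mem.FullSubcategory)ᵒᵖ (tensorLeft X)
  preserves_tensorRight (X : V) :
    PreservesColimitsOfShape (Φ.mem.FullSubcategory)ᵒᵖ (tensorRight X)
  preserves_unit :
    PreservesColimitsOfShape (Φ.mem.FullSubcategory)ᵒᵖ (coyoneda.obj (op (𝟙_ V)))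

attribute [instance] HasFilterColimits.hasColimitsOfShape HasFilterColimits.preserves_tensorLeft
  HasFilterColimits.preserves_tensorRight HasFilterColimits.preserves_unit

variable {Φ} in
lemma exists_fac_of_isColimit {V : Type u'} [Category.{v'} V] {K : V}
    [PreservesColimitsOfShape (Φ.mem.FullSubcategory)ᵒᵖ (coyoneda.obj (op K))]
    {F : (Φ.mem.FullSubcategory)ᵒᵖ ⥤ V} {c : Cocone F} (hc : IsColimit c) (f : K ⟶ c.pt) :
    ∃ (U : Φ.mem.FullSubcategory) (p : K ⟶ F.obj (op U)), p ≫ c.ι.app (op U) = f :=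
  let ⟨U, p, h⟩ :=
    Types.jointly_surjective_of_isColimit (isColimitOfPreserves (coyoneda.obj (op K)) hc) f
  ⟨U.unop, p, h⟩

variable {Φ} in
lemma exists_eq_of_isColimit {V : Type u'} [Category.{v'} V] {K : V}
    [PreservesColimitsOfShape (Φ.mem.FullSubcategory)ᵒᵖ (coyoneda.obj (op K))]
    {F : (Φ.mem.FullSubcategory)ᵒᵖ ⥤ V} {c : Cocone F} (hc : IsColimit c)
    {U : Φ.mem.FullSubcategory} (f g : K ⟶ F.obj (op U))
    (h : f ≫ c.ι.app (op U) = g ≫ c.ι.app (op U)) :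
    ∃ (W : Φ.mem.FullSubcategory) (a : W ⟶ U), f ≫ F.map a.op = g ≫ F.map a.op := by
  obtain ⟨W, a, b, e⟩ := (Types.FilteredColimit.isColimit_eq_iff _
    (isColimitOfPreserves (coyoneda.obj (op K)) hc)).mp h
  -- Equality in the filtered colimit yields two transition arrows, which coincide because `U` is
  -- subterminal.
  have : b = a := Quiver.Hom.unop_inj (by ext; exact hom_eq U.property _ _)
  subst this
  exact ⟨W.unop, b.unop, e⟩

section

variable (V : Type u') [Category.{v'} V] [MonoidalCategory V]
  [EnrichedOrdinaryCategory V M] [Φ.HasEnrichedProducts V] [Φ.HasFilterColimits V]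

/-- The mapping objects `colim_U Map(X × U, Y × U)` of the quotient. -/
def mapColim (X Y : M) : V := colimit (Φ.mapDiagram V X Y)

/-- The inclusion of the stage `U` in the colimit of the mapping objects. -/
def ιMap (X Y : M) (U : Φ.mem.FullSubcategory) :
    ((X ⨯ U.obj) ⟶[V] (Y ⨯ U.obj)) ⟶ Φ.mapColim V X Y :=
  colimit.ι (Φ.mapDiagram V X Y) (op U)

@[simp]
lemma trans_ιMap (X Y : M) {U W : Φ.mem.FullSubcategory} (h : W ⟶ U) :
    trans V X Y h ≫ Φ.ιMap V X Y W = Φ.ιMap V X Y U :=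
  colimit.w (Φ.mapDiagram V X Y) h.op

variable {Φ V} in
lemma mapColim_hom_ext {X Y : M} {K : V} {f g : Φ.mapColim V X Y ⟶ K}
    (h : ∀ U, Φ.ιMap V X Y U ≫ f = Φ.ιMap V X Y U ≫ g) : f = g :=
  colimit.hom_ext fun U => h U.unop

instance (F G : (Φ.mem.FullSubcategory)ᵒᵖ ⥤ V) : PreservesColimit₂ F G (curriedTensor V) :=
  have (X : V) : PreservesColimit F ((curriedTensor V).flip.obj X) :=
    (HasFilterColimits.preserves_tensorRight X).preservesColimit
  inferInstance

/-- The colimit cocone with point `Map(X, Y) ⊗ Map(Y', Z)`. -/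
def isColimitTensorMapColim (X Y Y' Z : M) :
    IsColimit ((colimit.cocone (Φ.mapDiagram V X Y)).tensor
      (colimit.cocone (Φ.mapDiagram V Y' Z))) :=
  (colimit.isColimit _).tensor (colimit.isColimit _)

variable {Φ V} in
lemma tensor_tensor_mapColim_hom_ext {X Y Y' Z Z' T : M} {K : V}
    {f g : Φ.mapColim V X Y ⊗ Φ.mapColim V Y' Z ⊗ Φ.mapColim V Z' T ⟶ K}
    (h : ∀ U, (Φ.ιMap V X Y U ⊗ₘ Φ.ιMap V Y' Z U ⊗ₘ Φ.ιMap V Z' T U) ≫ f =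
      (Φ.ιMap V X Y U ⊗ₘ Φ.ιMap V Y' Z U ⊗ₘ Φ.ιMap V Z' T U) ≫ g) : f = g :=
  ((colimit.isColimit (Φ.mapDiagram V X Y)).tensor
    (Φ.isColimitTensorMapColim V Y' Z Z' T)).hom_ext fun U => h U.unop

/-- The composition of the mapping objects of the quotient. -/
def mapColimComp (X Y Z : M) :
    Φ.mapColim V X Y ⊗ Φ.mapColim V Y Z ⟶ Φ.mapColim V X Z :=
  (Φ.isColimitTensorMapColim V X Y Y Z).desc
    { pt := Φ.mapColim V X Z
      ι :=
        { app U := eComp V (X ⨯ U.unop.obj) (Y ⨯ U.unop.obj) (Z ⨯ U.unop.obj) ≫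
            Φ.ιMap V X Z U.unop
          naturality U W h := by
            have key : (trans V X Y h.unop ⊗ₘ trans V Y Z h.unop) ≫
                eComp V (X ⨯ W.unop.obj) (Y ⨯ W.unop.obj) (Z ⨯ W.unop.obj) ≫
                  Φ.ιMap V X Z W.unop =
                eComp V (X ⨯ U.unop.obj) (Y ⨯ U.unop.obj) (Z ⨯ U.unop.obj) ≫
                  Φ.ιMap V X Z U.unop := by
              rw [← reassoc_of% eComp_trans, trans_ιMap]
            exact key.trans (Category.comp_id _).symm } }

@[simp]
lemma ιMap_tensor_ιMap_mapColimComp (X Y Z : M) (U : Φ.mem.FullSubcategory) :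
    (Φ.ιMap V X Y U ⊗ₘ Φ.ιMap V Y Z U) ≫ Φ.mapColimComp V X Y Z =
      eComp V (X ⨯ U.obj) (Y ⨯ U.obj) (Z ⨯ U.obj) ≫ Φ.ιMap V X Z U :=
  (Φ.isColimitTensorMapColim V X Y Y Z).fac _ (op U)

/-- A member of the filter. -/
def someMem : Φ.mem.FullSubcategory := ⟨_, Φ.nonempty.choose_spec⟩

variable {Φ} in
-- Independence of the representative: the transition maps act on global elements by `res`, and the
-- two representatives agree after restriction.
lemma eHomEquiv_ιMap_eq_of_stage_eq {X Y : M} {U U' : Φ.mem.FullSubcategory}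
    {f : X ⨯ U.obj ⟶ Y ⨯ U.obj} {f' : X ⨯ U'.obj ⟶ Y ⨯ U'.obj}
    (h : stage U.property f = stage U'.property f') :
    eHomEquiv V f ≫ Φ.ιMap V X Y U = eHomEquiv V f' ≫ Φ.ιMap V X Y U' := by
  obtain ⟨W, hW, a, b, h⟩ := (stage_eq_stage_iff _ _ _ _).1 h
  rw [← Φ.trans_ιMap V X Y (W := ⟨W, hW⟩) (U := U) ⟨a⟩,
    ← Φ.trans_ιMap V X Y (W := ⟨W, hW⟩) (U := U') ⟨b⟩, reassoc_of% eHomEquiv_trans,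
    reassoc_of% eHomEquiv_trans]
  exact congr(eHomEquiv V $h ≫ _)

/-- The global element of the mapping object of the quotient given by a morphism. -/
def homToMapColim {X Y : M} (φ : Φ.proj.obj X ⟶ Φ.proj.obj Y) : 𝟙_ V ⟶ Φ.mapColim V X Y :=
  eHomEquiv V (exists_eq_stage φ).choose_spec.choose_spec.choose ≫
    Φ.ιMap V X Y ⟨_, (exists_eq_stage φ).choose_spec.choose⟩

lemma homToMapColim_stage {X Y : M} (U : Φ.mem.FullSubcategory)
    (f : X ⨯ U.obj ⟶ Y ⨯ U.obj) :
    Φ.homToMapColim V (stage U.property f) = eHomEquiv V f ≫ Φ.ιMap V X Y U :=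
  eHomEquiv_ιMap_eq_of_stage_eq V
    (U := ⟨_, (exists_eq_stage (stage U.property f)).choose_spec.choose⟩) (U' := U)
    (exists_eq_stage (stage U.property f)).choose_spec.choose_spec.choose_spec.symm

lemma stage_eq_of_eHomEquiv_ιMap_eq {X Y : M} {U : Φ.mem.FullSubcategory}
    {f g : X ⨯ U.obj ⟶ Y ⨯ U.obj}
    (h : eHomEquiv V f ≫ Φ.ιMap V X Y U = eHomEquiv V g ≫ Φ.ιMap V X Y U) :
    stage U.property f = stage U.property g := by
  obtain ⟨W, a, e⟩ := exists_eq_of_isColimit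
    (colimit.isColimit (Φ.mapDiagram V X Y)) (eHomEquiv V f) (eHomEquiv V g) h
  change eHomEquiv V f ≫ trans V X Y a = eHomEquiv V g ≫ trans V X Y a at e
  rw [eHomEquiv_trans, eHomEquiv_trans] at e
  rw [← stage_res U.property W.property a.hom f, ← stage_res U.property W.property a.hom g,
    (eHomEquiv V).injective e]

/-- Both halves are compactness of the unit: a global element of the colimit, and an equality
between two of them, already live at a stage. -/
lemma homToMapColim_bijective (X Y : M) :
    Function.Bijective (Φ.homToMapColim V (X := X) (Y := Y)) := by
  constructor
  · intro φ ψ h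
    obtain ⟨U, hU, f, g, rfl, rfl⟩ := exists_eq_stage₂ φ ψ
    refine Φ.stage_eq_of_eHomEquiv_ιMap_eq V (U := ⟨U, hU⟩) ?_
    rw [← homToMapColim_stage, ← homToMapColim_stage]
    exact h
  · intro x
    obtain ⟨U, p, rfl⟩ := exists_fac_of_isColimit (colimit.isColimit (Φ.mapDiagram V X Y)) x
    obtain ⟨f, rfl⟩ := (eHomEquiv V).surjective p
    exact ⟨stage U.property f, Φ.homToMapColim_stage V U f⟩

variable {V} in
lemma eId_ιMap (X : M) (U W : Φ.mem.FullSubcategory) :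
    eId V (X ⨯ U.obj) ≫ Φ.ιMap V X X U = eId V (X ⨯ W.obj) ≫ Φ.ιMap V X X W := by
  rw [← eHomEquiv_id, ← eHomEquiv_id]
  exact eHomEquiv_ιMap_eq_of_stage_eq V (by rw [stage_id, stage_id])

lemma homToMapColim_stage_comp {X Y Z : M} (U : Φ.mem.FullSubcategory)
    (f : X ⨯ U.obj ⟶ Y ⨯ U.obj) (g : Y ⨯ U.obj ⟶ Z ⨯ U.obj) :
    Φ.homToMapColim V (stage U.property f ≫ stage U.property g) =
      (λ_ _).inv ≫ (Φ.homToMapColim V (stage U.property f) ⊗ₘ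
        Φ.homToMapColim V (stage U.property g)) ≫ Φ.mapColimComp V X Y Z := by
  rw [stage_comp, homToMapColim_stage, homToMapColim_stage, homToMapColim_stage,
    ← tensorHom_comp_tensorHom_assoc, ιMap_tensor_ιMap_mapColimComp, eHomEquiv_comp]
  simp only [Category.assoc]

/-- The laws are checked at each stage, as the stages are jointly epimorphic, also after tensoring.
The identity is taken at an arbitrary stage, and `eId_ιMap` moves it to the one under consideration.
-/
instance : EnrichedOrdinaryCategory V Φ.QuotientCat where
  Hom X Y := Φ.mapColim V X.base Y.base
  id X := eId V (X.base ⨯ Φ.someMem.obj) ≫ Φ.ιMap V X.base X.base Φ.someMem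
  comp X Y Z := Φ.mapColimComp V X.base Y.base Z.base
  id_comp X Y := mapColim_hom_ext fun U => by
    rw [Φ.eId_ιMap _ _ U, leftUnitor_inv_naturality_assoc, whisker_exchange_assoc,
      comp_whiskerRight_assoc, ← tensorHom_def_assoc, ιMap_tensor_ιMap_mapColimComp,
      e_id_comp_assoc, Category.comp_id]
  comp_id X Y := mapColim_hom_ext fun U => by
    rw [Φ.eId_ιMap _ _ U, rightUnitor_inv_naturality_assoc, ← whisker_exchange_assoc,
      MonoidalCategory.whiskerLeft_comp_assoc, ← tensorHom_def'_assoc,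
      ιMap_tensor_ιMap_mapColimComp, e_comp_id_assoc, Category.comp_id]
  assoc X Y Z T := tensor_tensor_mapColim_hom_ext fun U => by
    rw [associator_inv_naturality_assoc, ← tensorHom_id, tensorHom_comp_tensorHom_assoc,
      ιMap_tensor_ιMap_mapColimComp, Category.comp_id, ← id_tensorHom,
      tensorHom_comp_tensorHom_assoc, ιMap_tensor_ιMap_mapColimComp, Category.comp_id,
      ← whiskerRight_comp_tensorHom_assoc, ← whiskerLeft_comp_tensorHom_assoc,
      ιMap_tensor_ιMap_mapColimComp, ιMap_tensor_ιMap_mapColimComp, e_assoc_assoc]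
  homEquiv {X Y} := Equiv.ofBijective (Φ.homToMapColim V (X := X.base) (Y := Y.base))
    (Φ.homToMapColim_bijective V X.base Y.base)
  homEquiv_id X := by
    refine Eq.trans ?_ (congrArg (· ≫ _) (eHomEquiv_id V _))
    rw [← Φ.homToMapColim_stage V Φ.someMem, stage_id]
    rfl
  homEquiv_comp {X Y Z} φ ψ := by
    obtain ⟨X, rfl⟩ := exists_eq_proj_obj Φ X
    obtain ⟨Y, rfl⟩ := exists_eq_proj_obj Φ Y
    obtain ⟨Z, rfl⟩ := exists_eq_proj_obj Φ Z
    obtain ⟨U, hU, f, g, rfl, rfl⟩ : ∃ (U : M) (hU : Φ.mem U) (f : X ⨯ U ⟶ Y ⨯ U)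
        (g : Y ⨯ U ⟶ Z ⨯ U), φ = stage hU f ∧ ψ = stage hU g := exists_eq_stage₂ φ ψ
    exact Φ.homToMapColim_stage_comp V ⟨U, hU⟩ f g

end

end ModelFilter

/-! ### Tensors and cotensors from universal arrows -/

section Universal

variable (V : Type u') [Category.{v'} V] [MonoidalCategory V]
  (N : Type u) [Category.{v} N] [EnrichedOrdinaryCategory V N]

/-- Tensors by compact objects, given by universal arrows `K ⟶ Map(X, X ⊗ K)`. -/
structure UniversalTensors where
  obj : N → Compact.{w} V → N
  unit (X : N) (K : Compact.{w} V) : K.obj ⟶ (X ⟶[V] obj X K)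
  bijective (X : N) (K : Compact.{w} V) (Y : N) :
    Function.Bijective fun f : obj X K ⟶ Y => unit X K ≫ eHomWhiskerLeft V X f

/-- Cotensors by compact objects, given by universal arrows `K ⟶ Map(Y ^ K, Y)`. -/
structure UniversalCotensors where
  obj : Compact.{w} V → N → N
  counit (K : Compact.{w} V) (Y : N) : K.obj ⟶ (obj K Y ⟶[V] Y)
  bijective (X : N) (K : Compact.{w} V) (Y : N) :
    Function.Bijective fun f : X ⟶ obj K Y => counit K Y ≫ eHomWhiskerRight V f Y

variable {V N}

namespace UniversalTensors

variable (T : UniversalTensors.{w} V N)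

/-- Morphisms out of a tensor. -/
def equiv (X : N) (K : Compact.{w} V) (Y : N) : (T.obj X K ⟶ Y) ≃ (K.obj ⟶ (X ⟶[V] Y)) :=
  Equiv.ofBijective _ (T.bijective X K Y)

lemma equiv_apply {X : N} {K : Compact.{w} V} {Y : N} (f : T.obj X K ⟶ Y) :
    T.equiv X K Y f = T.unit X K ≫ eHomWhiskerLeft V X f := rfl

lemma equiv_comp {X : N} {K : Compact.{w} V} {Y Z : N} (f : T.obj X K ⟶ Y) (g : Y ⟶ Z) :
    T.equiv X K Z (f ≫ g) = T.equiv X K Y f ≫ eHomWhiskerLeft V X g := by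
  simp [equiv_apply]

/-- The universal arrow classifies the identity. It enters through a separate `q` because the
comparison map is formed at an arbitrary stage, the universal arrow at a fixed one. -/
lemma isIso_equiv_symm {X : N} {K : Compact.{w} V} {q : K.obj ⟶ (X ⟶[V] T.obj X K)}
    (hq : q = T.unit X K) : IsIso ((T.equiv X K (T.obj X K)).symm q) := by
  have h : q = T.equiv _ K _ (𝟙 _) := by simp [equiv_apply, hq]
  rw [h, Equiv.symm_apply_apply]
  infer_instance

/-- The functoriality of the tensor in both variables. -/
def map {X X' : N} (a : X ⟶ X') {K K' : Compact.{w} V} (k : K ⟶ K') : T.obj X K ⟶ T.obj X' K' :=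
  (T.equiv _ _ _).symm (k.hom ≫ T.unit X' K' ≫ eHomWhiskerRight V a _)

lemma equiv_map_comp {X X' : N} (a : X ⟶ X') {K K' : Compact.{w} V} (k : K ⟶ K') {Y : N}
    (f : T.obj X' K' ⟶ Y) :
    T.equiv X K Y (T.map a k ≫ f) = k.hom ≫ T.equiv X' K' Y f ≫ eHomWhiskerRight V a Y := by
  rw [equiv_comp, map, Equiv.apply_symm_apply, equiv_apply, Category.assoc, Category.assoc,
    Category.assoc, eHom_whisker_exchange]

lemma map_id (X : N) (K : Compact.{w} V) : T.map (𝟙 X) (𝟙 K) = 𝟙 _ :=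
  (T.equiv _ _ _).injective (by
    rw [← Category.comp_id (T.map _ _), equiv_map_comp]
    simp)

lemma map_comp_map {X X' X'' : N} (a : X ⟶ X') (a' : X' ⟶ X'') {K K' K'' : Compact.{w} V}
    (k : K ⟶ K') (k' : K' ⟶ K'') : T.map a k ≫ T.map a' k' = T.map (a ≫ a') (k ≫ k') :=
  (T.equiv _ _ _).injective (by
    rw [equiv_map_comp, ← Category.comp_id (T.map _ _), equiv_map_comp,
      ← Category.comp_id (T.map _ _), equiv_map_comp]
    simp)

/-- The tensor as a bifunctor. -/
def functor : N ⥤ Compact.{w} V ⥤ N where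
  obj X :=
    { obj K := T.obj X K
      map k := T.map (𝟙 X) k
      map_id K := T.map_id X K
      map_comp k k' := by rw [map_comp_map, Category.comp_id] }
  map a :=
    { app K := T.map a (𝟙 K)
      naturality K K' k := by simp only [map_comp_map, Category.id_comp, Category.comp_id] }
  map_id X := by
    ext K
    exact T.map_id X K
  map_comp a a' := by
    ext K
    exact (congrArg (T.map (a ≫ a')) (Category.comp_id (𝟙 K)).symm).trans
      (T.map_comp_map a a' (𝟙 K) (𝟙 K)).symm

end UniversalTensors

namespace UniversalCotensors

variable (T : UniversalCotensors.{w} V N)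

/-- Morphisms into a cotensor. -/
def equiv (X : N) (K : Compact.{w} V) (Y : N) : (X ⟶ T.obj K Y) ≃ (K.obj ⟶ (X ⟶[V] Y)) :=
  Equiv.ofBijective _ (T.bijective X K Y)

lemma equiv_apply {X : N} {K : Compact.{w} V} {Y : N} (f : X ⟶ T.obj K Y) :
    T.equiv X K Y f = T.counit K Y ≫ eHomWhiskerRight V f Y := rfl

lemma equiv_comp {X Z : N} {K : Compact.{w} V} {Y : N} (g : Z ⟶ X) (f : X ⟶ T.obj K Y) :
    T.equiv Z K Y (g ≫ f) = T.equiv X K Y f ≫ eHomWhiskerRight V g Y := by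
  simp [equiv_apply]

lemma isIso_equiv_symm {K : Compact.{w} V} {Y : N} {q : K.obj ⟶ (T.obj K Y ⟶[V] Y)}
    (hq : q = T.counit K Y) : IsIso ((T.equiv (T.obj K Y) K Y).symm q) := by
  have h : q = T.equiv _ K _ (𝟙 _) := by simp [equiv_apply, hq]
  rw [h, Equiv.symm_apply_apply]
  infer_instance

/-- The functoriality of the cotensor in both variables. -/
def map {K K' : Compact.{w} V} (k : K' ⟶ K) {Y Y' : N} (b : Y ⟶ Y') : T.obj K Y ⟶ T.obj K' Y' :=
  (T.equiv _ _ _).symm (k.hom ≫ T.counit K Y ≫ eHomWhiskerLeft V _ b)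

lemma equiv_comp_map {X : N} {K K' : Compact.{w} V} (k : K' ⟶ K) {Y Y' : N} (b : Y ⟶ Y')
    (f : X ⟶ T.obj K Y) :
    T.equiv X K' Y' (f ≫ T.map k b) = k.hom ≫ T.equiv X K Y f ≫ eHomWhiskerLeft V X b := by
  rw [equiv_comp, map, Equiv.apply_symm_apply, equiv_apply, Category.assoc, Category.assoc,
    Category.assoc, eHom_whisker_exchange]

lemma map_id (K : Compact.{w} V) (Y : N) : T.map (𝟙 K) (𝟙 Y) = 𝟙 _ :=
  (T.equiv _ _ _).injective (by
    rw [← Category.id_comp (T.map _ _), equiv_comp_map]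
    simp)

lemma map_comp_map {K K' K'' : Compact.{w} V} (k : K' ⟶ K) (k' : K'' ⟶ K') {Y Y' Y'' : N}
    (b : Y ⟶ Y') (b' : Y' ⟶ Y'') :
    T.map k b ≫ T.map k' b' = T.map (k' ≫ k) (b ≫ b') :=
  (T.equiv _ _ _).injective (by
    rw [equiv_comp_map, ← Category.id_comp (T.map _ _), equiv_comp_map,
      ← Category.id_comp (T.map _ _), equiv_comp_map]
    simp)

/-- The cotensor as a bifunctor. -/
def functor : (Compact.{w} V)ᵒᵖ ⥤ N ⥤ N where
  obj K :=
    { obj Y := T.obj K.unop Y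
      map b := T.map (𝟙 K.unop) b
      map_id Y := T.map_id K.unop Y
      map_comp b b' := by rw [map_comp_map, Category.comp_id] }
  map k :=
    { app Y := T.map k.unop (𝟙 Y)
      naturality Y Y' b := by simp only [map_comp_map, Category.id_comp, Category.comp_id] }
  map_id K := by
    ext Y
    exact T.map_id K.unop Y
  map_comp k k' := by
    ext Y
    exact (congrArg (T.map (k'.unop ≫ k.unop)) (Category.comp_id (𝟙 Y)).symm).trans
      (T.map_comp_map k.unop k'.unop (𝟙 Y) (𝟙 Y)).symm

end UniversalCotensors

lemma UniversalTensors.equiv_naturality (T : UniversalTensors.{w} V N) {X X' Y Y' : N}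
    {K K' : Compact.{w} V} (a : X' ⟶ X) (k : K' ⟶ K) (b : Y ⟶ Y') (f : T.obj X K ⟶ Y) :
    T.equiv X' K' Y' ((T.functor.map a).app K' ≫ (T.functor.obj X).map k ≫ f ≫ b) =
      k.hom ≫ T.equiv X K Y f ≫ eHomWhiskerRight V a Y ≫ eHomWhiskerLeft V X' b := by
  have h : T.equiv X' K' Y' (T.map a (𝟙 K') ≫ T.map (𝟙 X) k ≫ f ≫ b) =
      k.hom ≫ T.equiv X K Y f ≫ eHomWhiskerRight V a Y ≫ eHomWhiskerLeft V X' b := by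
    rw [equiv_map_comp, equiv_map_comp, equiv_comp]
    simp [eHom_whisker_exchange]
  exact h

lemma UniversalCotensors.equiv_naturality (T : UniversalCotensors.{w} V N) {X X' Y Y' : N}
    {K K' : Compact.{w} V} (a : X' ⟶ X) (k : K' ⟶ K) (b : Y ⟶ Y') (f : X ⟶ T.obj K Y) :
    T.equiv X' K' Y'
        (a ≫ f ≫ (T.functor.map k.op).app Y ≫ (T.functor.obj (op K')).map b) =
      k.hom ≫ T.equiv X K Y f ≫ eHomWhiskerRight V a Y ≫ eHomWhiskerLeft V X' b := by
  have h : T.equiv X' K' Y' (a ≫ f ≫ T.map k (𝟙 Y) ≫ T.map (𝟙 K') b) =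
      k.hom ≫ T.equiv X K Y f ≫ eHomWhiskerRight V a Y ≫ eHomWhiskerLeft V X' b := by
    rw [← Category.assoc, ← Category.assoc, equiv_comp_map, equiv_comp_map, equiv_comp]
    simp
  exact h

end Universal

section CompactlyEnriched

variable {V : Type u'} [Category.{v'} V] [MonoidalCategory V] [ModelCategory V]
  {M : Type u} [Category.{v} M] [ModelCategory M] [CompactlyEnriched.{w} V M]

/-- Yoneda: the natural bijection is determined by its value at the identity. -/
lemma tensorEquiv_eq {X : M} {K : Compact.{w} V} {Y : M} (f : tens V X K ⟶ Y) :
    CompactlyEnriched.tensorEquiv X K Y f = tensUnit V X K ≫ eHomWhiskerLeft V X f := by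
  simpa [tensUnit] using CompactlyEnriched.tensorEquiv_naturality (𝟙 X) (𝟙 K) f (𝟙 _)

lemma cotensorEquiv_eq {X : M} {K : Compact.{w} V} {Y : M} (f : X ⟶ cotens V K Y) :
    CompactlyEnriched.cotensorEquiv X K Y f = cotensCounit V K Y ≫ eHomWhiskerRight V f Y := by
  simpa [cotensCounit] using CompactlyEnriched.cotensorEquiv_naturality f (𝟙 K) (𝟙 Y) (𝟙 _)

lemma tensorEquiv_tensMap {X X' : M} (a : X' ⟶ X) (K : Compact.{w} V) :
    CompactlyEnriched.tensorEquiv X' K _ (tensMap V a K) =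
      tensUnit V X K ≫ eHomWhiskerRight V a (tens V X K) := by
  simpa [tensUnit] using CompactlyEnriched.tensorEquiv_naturality a (𝟙 K) (𝟙 _) (𝟙 (tens V X K))

end CompactlyEnriched

/-! ### Mapping objects, tensors and cotensors of the quotient. -/

namespace ModelFilter

variable {M : Type u} [Category.{v} M] [ModelCategory M] (Φ : ModelFilter M)

variable {Φ} in
lemma exists_eq_fullSubcategory_stage₂ {X X' Y Y' : M} (φ : Φ.proj.obj X ⟶ Φ.proj.obj Y)
    (ψ : Φ.proj.obj X' ⟶ Φ.proj.obj Y') :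
    ∃ (U : Φ.mem.FullSubcategory) (f : X ⨯ U.obj ⟶ Y ⨯ U.obj) (g : X' ⨯ U.obj ⟶ Y' ⨯ U.obj),
      φ = stage U.property f ∧ ψ = stage U.property g :=
  let ⟨U, hU, f, g, hf, hg⟩ := exists_eq_stage₂ φ ψ
  ⟨⟨U, hU⟩, f, g, hf, hg⟩

section

variable (V : Type u') [Category.{v'} V] [MonoidalCategory V]
  [EnrichedOrdinaryCategory V M] [Φ.HasEnrichedProducts V]

/-- The enrichment of the quotient is the induced one. -/
def inducedEnrichment [Φ.HasFilterColimits V] : Φ.InducedEnrichment V where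
  ι X Y := (colimit.cocone (Φ.mapDiagram V X Y)).ι
  isColimit X Y := colimit.isColimit (Φ.mapDiagram V X Y)
  eHomEquiv_homMk U f := Φ.homToMapColim_stage V U f
  eComp_eq X Y Z U := Φ.ιMap_tensor_ιMap_mapColimComp V X Y Z U

namespace InducedEnrichment

variable {Φ V} [EnrichedOrdinaryCategory V Φ.QuotientCat] (I : Φ.InducedEnrichment V)

/-- The morphism `Map(X × U, Y × U) ⟶ Map(P_Φ X, P_Φ Y)`. -/
def inc (X Y : M) (U : Φ.mem.FullSubcategory) :
    ((X ⨯ U.obj) ⟶[V] (Y ⨯ U.obj)) ⟶ (Φ.proj.obj X ⟶[V] Φ.proj.obj Y) :=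
  (I.ι X Y).app (op U)

@[simp]
lemma trans_inc (X Y : M) {U W : Φ.mem.FullSubcategory} (h : W ⟶ U) :
    trans V X Y h ≫ I.inc X Y W = I.inc X Y U :=
  (Cocone.mk _ (I.ι X Y)).w h.op

lemma eHomEquiv_stage {X Y : M} (U : Φ.mem.FullSubcategory) (f : X ⨯ U.obj ⟶ Y ⨯ U.obj) :
    eHomEquiv V (stage U.property f) = eHomEquiv V f ≫ I.inc X Y U :=
  I.eHomEquiv_homMk U f

lemma inc_tensor_inc_eComp (X Y Z : M) (U : Φ.mem.FullSubcategory) :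
    (I.inc X Y U ⊗ₘ I.inc Y Z U) ≫ eComp V (Φ.proj.obj X) (Φ.proj.obj Y) (Φ.proj.obj Z) =
      eComp V (X ⨯ U.obj) (Y ⨯ U.obj) (Z ⨯ U.obj) ≫ I.inc X Z U :=
  I.eComp_eq X Y Z U

lemma inc_eHomWhiskerLeft (X : M) {Y Z : M} (U : Φ.mem.FullSubcategory)
    (f : Y ⨯ U.obj ⟶ Z ⨯ U.obj) :
    I.inc X Y U ≫ eHomWhiskerLeft V (Φ.proj.obj X) (stage U.property f) =
      eHomWhiskerLeft V (X ⨯ U.obj) f ≫ I.inc X Z U := by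
  rw [eHomWhiskerLeft, eHomWhiskerLeft, rightUnitor_inv_naturality_assoc, I.eHomEquiv_stage,
    MonoidalCategory.whiskerLeft_comp_assoc, ← whisker_exchange_assoc, ← tensorHom_def_assoc,
    I.inc_tensor_inc_eComp, Category.assoc, Category.assoc]

lemma inc_eHomWhiskerRight {X Y : M} (Z : M) (U : Φ.mem.FullSubcategory)
    (f : X ⨯ U.obj ⟶ Y ⨯ U.obj) :
    I.inc Y Z U ≫ eHomWhiskerRight V (stage U.property f) (Φ.proj.obj Z) =
      eHomWhiskerRight V f (Z ⨯ U.obj) ≫ I.inc X Z U := by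
  rw [eHomWhiskerRight, eHomWhiskerRight, leftUnitor_inv_naturality_assoc, I.eHomEquiv_stage,
    comp_whiskerRight_assoc, whisker_exchange_assoc, ← tensorHom_def'_assoc,
    I.inc_tensor_inc_eComp, Category.assoc, Category.assoc]

lemma exists_comp_inc_eq {X Y : M} {K : V}
    [PreservesColimitsOfShape (Φ.mem.FullSubcategory)ᵒᵖ (coyoneda.obj (op K))]
    (f : K ⟶ (Φ.proj.obj X ⟶[V] Φ.proj.obj Y)) :
    ∃ (U : Φ.mem.FullSubcategory) (p : K ⟶ ((X ⨯ U.obj) ⟶[V] (Y ⨯ U.obj))),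
      p ≫ I.inc X Y U = f :=
  exists_fac_of_isColimit (I.isColimit X Y) f

lemma exists_comp_trans_eq {X Y : M} {K : V}
    [PreservesColimitsOfShape (Φ.mem.FullSubcategory)ᵒᵖ (coyoneda.obj (op K))]
    {U : Φ.mem.FullSubcategory} (f g : K ⟶ ((X ⨯ U.obj) ⟶[V] (Y ⨯ U.obj)))
    (h : f ≫ I.inc X Y U = g ≫ I.inc X Y U) :
    ∃ (W : Φ.mem.FullSubcategory) (a : W ⟶ U), f ≫ trans V X Y a = g ≫ trans V X Y a :=
  exists_eq_of_isColimit (I.isColimit X Y) f g h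

lemma projMap_eq_comp_inc (U : Φ.mem.FullSubcategory) (X Y : M) :
    I.projMap Φ U X Y = Φ.prodMap V X Y U ≫ I.inc X Y U := rfl

/-- Both stages restrict to a common one, and the transition maps carry `prodMap` to `prodMap`. -/
lemma projMap_eq (U W : Φ.mem.FullSubcategory) (X Y : M) :
    I.projMap Φ U X Y = I.projMap Φ W X Y := by
  obtain ⟨Z, hZ, ⟨a⟩, ⟨b⟩⟩ := Φ.directed U.property W.property
  rw [projMap_eq_comp_inc, projMap_eq_comp_inc, ← I.trans_inc X Y (W := ⟨Z, hZ⟩) (U := U) ⟨a⟩,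
    ← I.trans_inc X Y (W := ⟨Z, hZ⟩) (U := W) ⟨b⟩, reassoc_of% prodMap_trans,
    reassoc_of% prodMap_trans]

end InducedEnrichment

end

section

variable {Φ} {V : Type u'} [Category.{v'} V] [MonoidalCategory V] [ModelCategory V]
  [CompactlyEnriched.{w} V M] [Φ.HasEnrichedProducts V]

/-- The morphism `K ⟶ Map(X × U, (X ⊗ K) × U)` is a universal arrow. -/
lemma bijective_tensUnit_prodMap [Φ.IsEnriched V] (X : M) (K : Compact.{w} V) (Y : M)
    (U : Φ.mem.FullSubcategory) :
    Function.Bijective fun f : tens V X K ⨯ U.obj ⟶ Y ⨯ U.obj =>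
      tensUnit V X K ≫ Φ.prodMap V X (tens V X K) U ≫ eHomWhiskerLeft V (X ⨯ U.obj) f := by
  obtain ⟨e, he⟩ := IsEnriched.exists_iso (Φ := Φ) (V := V) X K U.property
  -- Under `Map(X × U, Y × U) ≅ Map(X × U, Y)` the map becomes the tensor bijection of `X × U`,
  -- precomposed with the isomorphism `e`.
  have key (f : tens V X K ⨯ U.obj ⟶ Y ⨯ U.obj) :
      (tensUnit V X K ≫ Φ.prodMap V X (tens V X K) U ≫ eHomWhiskerLeft V (X ⨯ U.obj) f) ≫
        eHomWhiskerLeft V (X ⨯ U.obj) prod.fst =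
      CompactlyEnriched.tensorEquiv (X ⨯ U.obj) K Y (e.inv ≫ f ≫ prod.fst) := by
    have h : tensUnit V X K ≫ Φ.prodMap V X (tens V X K) U =
        tensUnit V (X ⨯ U.obj) K ≫ eHomWhiskerLeft V (X ⨯ U.obj) e.inv := by
      refine eHom_ext_fst V prod.snd ?_
      rw [Category.assoc, Category.assoc, prodMap_fst, ← eHomWhiskerLeft_comp, ← he,
        Iso.inv_hom_id_assoc, ← tensorEquiv_eq, tensorEquiv_tensMap]
    rw [reassoc_of% h, tensorEquiv_eq]
    simp
  constructor
  · intro f g h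
    have := (key f).symm.trans (congr($h ≫ eHomWhiskerLeft V _ prod.fst).trans (key g))
    refine prod_hom_ext U.property ((cancel_epi e.inv).1 ?_)
    exact (CompactlyEnriched.tensorEquiv _ _ _).injective this
  · intro q
    obtain ⟨f, hf⟩ := (CompactlyEnriched.tensorEquiv (X ⨯ U.obj) K Y).surjective
      (q ≫ eHomWhiskerLeft V (X ⨯ U.obj) prod.fst)
    refine ⟨prod.lift (e.hom ≫ f) prod.snd, eHom_ext_fst V prod.snd ?_⟩
    exact (key _).trans (by rw [prod.lift_fst, Iso.inv_hom_id_assoc, hf])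

/-- The morphism `K ⟶ Map((Y ^ K) × U, Y × U)` is a universal arrow. -/
lemma bijective_cotensCounit_prodMap (X : M) (K : Compact.{w} V) (Y : M)
    (U : Φ.mem.FullSubcategory) :
    Function.Bijective fun f : X ⨯ U.obj ⟶ cotens V K Y ⨯ U.obj =>
      cotensCounit V K Y ≫ Φ.prodMap V (cotens V K Y) Y U ≫
        eHomWhiskerRight V f (Y ⨯ U.obj) := by
  -- No analogue of `IsEnriched` is needed here: morphisms into `(Y ^ K) × U` from `X × U` are just
  -- morphisms into `Y ^ K`.
  have key (f : X ⨯ U.obj ⟶ cotens V K Y ⨯ U.obj) :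
      (cotensCounit V K Y ≫ Φ.prodMap V (cotens V K Y) Y U ≫
        eHomWhiskerRight V f (Y ⨯ U.obj)) ≫ eHomWhiskerLeft V (X ⨯ U.obj) prod.fst =
      CompactlyEnriched.cotensorEquiv (X ⨯ U.obj) K Y (f ≫ prod.fst) := by
    rw [cotensorEquiv_eq, Category.assoc, Category.assoc, ← eHom_whisker_exchange,
      reassoc_of% prodMap_fst, eHomWhiskerRight_comp]
  constructor
  · intro f g h
    have := (key f).symm.trans (congr($h ≫ eHomWhiskerLeft V _ prod.fst).trans (key g))
    exact prod_hom_ext U.property ((CompactlyEnriched.cotensorEquiv _ _ _).injective this)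
  · intro q
    obtain ⟨f, hf⟩ := (CompactlyEnriched.cotensorEquiv (X ⨯ U.obj) K Y).surjective
      (q ≫ eHomWhiskerLeft V (X ⨯ U.obj) prod.fst)
    refine ⟨prod.lift f prod.snd, eHom_ext_fst V prod.snd ?_⟩
    exact (key _).trans (by rw [prod.lift_fst, hf])

variable [EnrichedOrdinaryCategory V Φ.QuotientCat] (I : Φ.InducedEnrichment V)
  [∀ K : Compact.{w} V,
    PreservesColimitsOfShape (Φ.mem.FullSubcategory)ᵒᵖ (coyoneda.obj (op K.obj))]

/-- The colimit of the bijections `bijective_tensUnit_prodMap`: as `K` is compact, arrows out of `K`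
and their equalities live at a stage. The stage `U₀` is immaterial by `projMap_eq`. -/
lemma InducedEnrichment.bijective_tensUnit_projMap [Φ.IsEnriched V] (X : M)
    (K : Compact.{w} V) (Y : M) (U₀ : Φ.mem.FullSubcategory) :
    Function.Bijective fun f : Φ.proj.obj (tens V X K) ⟶ Φ.proj.obj Y =>
      (tensUnit V X K ≫ I.projMap Φ U₀ X (tens V X K)) ≫
        eHomWhiskerLeft V (Φ.proj.obj X) f := by
  have key (U : Φ.mem.FullSubcategory) (f : tens V X K ⨯ U.obj ⟶ Y ⨯ U.obj) :
      (tensUnit V X K ≫ I.projMap Φ U₀ X (tens V X K)) ≫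
        eHomWhiskerLeft V (Φ.proj.obj X) (stage U.property f) =
      (tensUnit V X K ≫ Φ.prodMap V X (tens V X K) U ≫ eHomWhiskerLeft V (X ⨯ U.obj) f) ≫
        I.inc X Y U := by
    rw [I.projMap_eq U₀ U, I.projMap_eq_comp_inc]
    simp only [Category.assoc, I.inc_eHomWhiskerLeft]
  constructor
  · intro φ ψ h
    obtain ⟨U, f, g, rfl, rfl⟩ := exists_eq_fullSubcategory_stage₂ φ ψ
    obtain ⟨W, a, e⟩ := I.exists_comp_trans_eq _ _
      ((key U f).symm.trans (h.trans (key U g)))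
    rw [← stage_res U.property W.property a.hom f, ← stage_res U.property W.property a.hom g]
    congr 1
    apply (bijective_tensUnit_prodMap (V := V) X K Y W).injective
    simpa only [Category.assoc, eHomWhiskerLeft_trans, reassoc_of% prodMap_trans] using e
  · intro q
    obtain ⟨U, p, rfl⟩ := I.exists_comp_inc_eq q
    obtain ⟨f, rfl⟩ := (bijective_tensUnit_prodMap (V := V) X K Y U).surjective p
    exact ⟨stage U.property f, key U f⟩

lemma InducedEnrichment.bijective_cotensCounit_projMap (X : M)
    (K : Compact.{w} V) (Y : M) (U₀ : Φ.mem.FullSubcategory) :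
    Function.Bijective fun f : Φ.proj.obj X ⟶ Φ.proj.obj (cotens V K Y) =>
      (cotensCounit V K Y ≫ I.projMap Φ U₀ (cotens V K Y) Y) ≫
        eHomWhiskerRight V f (Φ.proj.obj Y) := by
  have key (U : Φ.mem.FullSubcategory) (f : X ⨯ U.obj ⟶ cotens V K Y ⨯ U.obj) :
      (cotensCounit V K Y ≫ I.projMap Φ U₀ (cotens V K Y) Y) ≫
        eHomWhiskerRight V (stage U.property f) (Φ.proj.obj Y) =
      (cotensCounit V K Y ≫ Φ.prodMap V (cotens V K Y) Y U ≫
        eHomWhiskerRight V f (Y ⨯ U.obj)) ≫ I.inc X Y U := by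
    rw [I.projMap_eq U₀ U, I.projMap_eq_comp_inc]
    simp only [Category.assoc, I.inc_eHomWhiskerRight]
  constructor
  · intro φ ψ h
    obtain ⟨U, f, g, rfl, rfl⟩ := exists_eq_fullSubcategory_stage₂ φ ψ
    obtain ⟨W, a, e⟩ := I.exists_comp_trans_eq _ _
      ((key U f).symm.trans (h.trans (key U g)))
    rw [← stage_res U.property W.property a.hom f, ← stage_res U.property W.property a.hom g]
    congr 1
    apply (bijective_cotensCounit_prodMap (V := V) X K Y W).injective
    simpa only [Category.assoc, eHomWhiskerRight_trans, reassoc_of% prodMap_trans] using e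
  · intro q
    obtain ⟨U, p, rfl⟩ := I.exists_comp_inc_eq q
    obtain ⟨f, rfl⟩ := (bijective_cotensCounit_prodMap (V := V) X K Y U).surjective p
    exact ⟨stage U.property f, key U f⟩

/-- The tensors of the quotient. -/
def InducedEnrichment.universalTensors [Φ.IsEnriched V] :
    UniversalTensors.{w} V Φ.QuotientCat where
  obj X K := Φ.proj.obj (tens V X.base K)
  unit X K := tensUnit V X.base K ≫ I.projMap Φ Φ.someMem X.base (tens V X.base K)
  bijective X K Y := I.bijective_tensUnit_projMap X.base K Y.base Φ.someMem

/-- The cotensors of the quotient. -/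
def InducedEnrichment.universalCotensors : UniversalCotensors.{w} V Φ.QuotientCat where
  obj K Y := Φ.proj.obj (cotens V K Y.base)
  counit K Y := cotensCounit V K Y.base ≫ I.projMap Φ Φ.someMem (cotens V K Y.base) Y.base
  bijective X K Y := I.bijective_cotensCounit_projMap X.base K Y.base Φ.someMem

end

end ModelFilter

/-! ### Pullback-powers -/

section PullbackPower

variable {V : Type u'} [Category.{v'} V] [MonoidalCategory V] [ModelCategory V]
  {N : Type u} [Category.{v} N] [EnrichedOrdinaryCategory V N]

instance {X X' : N} (f : X ⟶ X') [IsIso f] (Y : N) : IsIso (eHomWhiskerRight V f Y) :=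
  ⟨eHomWhiskerRight V (inv f) Y, by simp [← eHomWhiskerRight_comp],
    by simp [← eHomWhiskerRight_comp]⟩

instance (X : N) {Y Y' : N} (g : Y ⟶ Y') [IsIso g] : IsIso (eHomWhiskerLeft V X g) :=
  ⟨eHomWhiskerLeft V X (inv g), by simp [← eHomWhiskerLeft_comp],
    by simp [← eHomWhiskerLeft_comp]⟩

lemma pullbackPower_fst {A B X Y : N} (i : A ⟶ B) (p : Y ⟶ X) :
    pullbackPower V i p ≫ pullback.fst _ _ = eHomWhiskerLeft V B p :=
  pullback.lift_fst _ _ _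

lemma pullbackPower_snd {A B X Y : N} (i : A ⟶ B) (p : Y ⟶ X) :
    pullbackPower V i p ≫ pullback.snd _ _ = eHomWhiskerRight V i Y :=
  pullback.lift_snd _ _ _

/-- A property of a pullback-power can be checked on an arbitrary pullback. -/
lemma pullbackPower_iff_of_isPullback {S : MorphismProperty V} [S.RespectsIso] {A B X Y : N}
    (i : A ⟶ B) (p : Y ⟶ X) {Q : V} {fst : Q ⟶ (B ⟶[V] X)} {snd : Q ⟶ (A ⟶[V] Y)}
    (sq : IsPullback fst snd (eHomWhiskerRight V i X) (eHomWhiskerLeft V A p))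
    (f : (B ⟶[V] Y) ⟶ Q) (h₁ : f ≫ fst = eHomWhiskerLeft V B p)
    (h₂ : f ≫ snd = eHomWhiskerRight V i Y) :
    S (pullbackPower V i p) ↔ S f := by
  have : f ≫ sq.isoPullback.hom = pullbackPower V i p := by
    apply pullback.hom_ext
    · rw [Category.assoc, sq.isoPullback_hom_fst, h₁, pullbackPower_fst]
    · rw [Category.assoc, sq.isoPullback_hom_snd, h₂, pullbackPower_snd]
  rw [← this]
  exact MorphismProperty.cancel_right_of_respectsIso S f _

/-- The pullback-power is invariant under isomorphisms of arrows. -/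
lemma pullbackPower_iff_of_iso {S : MorphismProperty V} [S.RespectsIso] {A B X Y A' B' X' Y' : N}
    {i : A ⟶ B} {p : Y ⟶ X} {i' : A' ⟶ B'} {p' : Y' ⟶ X'}
    (e : Arrow.mk i ≅ Arrow.mk i') (f : Arrow.mk p ≅ Arrow.mk p') :
    S (pullbackPower V i p) ↔ S (pullbackPower V i' p') := by
  let eA : A ≅ A' := Arrow.leftFunc.mapIso e
  let eB : B ≅ B' := Arrow.rightFunc.mapIso e
  let eY : Y ≅ Y' := Arrow.leftFunc.mapIso f
  let eX : X ≅ X' := Arrow.rightFunc.mapIso f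
  have he : eA.inv ≫ i = i' ≫ eB.inv := e.inv.w
  have hf : eY.hom ≫ p' = p ≫ eX.hom := f.hom.w
  let m {C C' D D' : N} (c : C ≅ C') (d : D ≅ D') : (C ⟶[V] D) ≅ (C' ⟶[V] D') :=
    asIso (eHomWhiskerRight V c.inv D ≫ eHomWhiskerLeft V C' d.hom)
  have hm {C C' D D' : N} (c : C ≅ C') (d : D ≅ D') :
      (m c d).hom = eHomWhiskerRight V c.inv D ≫ eHomWhiskerLeft V C' d.hom := rfl
  -- The pullback formed from `i` and `p`, carried along the isomorphisms of mapping objects, is a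
  -- pullback for `i'` and `p'`.
  have sq : IsPullback
      (pullback.fst (eHomWhiskerRight V i X) (eHomWhiskerLeft V A p) ≫ (m eB eX).hom)
      (pullback.snd (eHomWhiskerRight V i X) (eHomWhiskerLeft V A p) ≫ (m eA eY).hom)
      (eHomWhiskerRight V i' X') (eHomWhiskerLeft V A' p') := by
    refine (IsPullback.of_hasPullback (eHomWhiskerRight V i X) (eHomWhiskerLeft V A p)).of_iso
      (Iso.refl _) (m eB eX) (m eA eY) (m eA eX) (by simp) (by simp) ?_ ?_
    · rw [hm, hm, ← eHomWhiskerRight_comp_assoc, he, eHomWhiskerRight_comp_assoc, Category.assoc,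
        eHom_whisker_exchange]
    · rw [hm, hm, Category.assoc, ← eHomWhiskerLeft_comp, hf, eHomWhiskerLeft_comp,
        eHom_whisker_exchange_assoc]
  refine (MorphismProperty.cancel_left_of_respectsIso S (m eB eY).inv _).symm.trans
    (pullbackPower_iff_of_isPullback i' p' sq ((m eB eY).inv ≫ pullbackPower V i p) ?_ ?_).symm
  · rw [Category.assoc, Iso.inv_comp_eq, reassoc_of% pullbackPower_fst, hm, hm,
      Category.assoc, ← eHomWhiskerLeft_comp, hf, eHomWhiskerLeft_comp,
      eHom_whisker_exchange_assoc]
  · rw [Category.assoc, Iso.inv_comp_eq, reassoc_of% pullbackPower_snd, hm, hm,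
      ← eHomWhiskerRight_comp_assoc, he, eHomWhiskerRight_comp_assoc, Category.assoc,
      eHom_whisker_exchange]

end PullbackPower

/-! ### Pullback-powers in the quotient. -/

namespace ModelFilter

variable {M : Type u} [Category.{v} M] [ModelCategory M] {Φ : ModelFilter M}

lemma quotientClass.exists_arrow_iso {S : MorphismProperty M} {X Y : Φ.QuotientCat} {φ : X ⟶ Y}
    (h : Φ.quotientClass S φ) :
    ∃ (X' Y' : M) (f : X' ⟶ Y'), S f ∧ Nonempty (Arrow.mk (Φ.proj.map f) ≅ Arrow.mk φ) := by
  obtain ⟨X, rfl⟩ := exists_eq_proj_obj Φ X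
  obtain ⟨Y, rfl⟩ := exists_eq_proj_obj Φ Y
  obtain ⟨U, hU, f, rfl, hf⟩ := quotientClass_iff.1 h
  exact ⟨_, _, f, hf, ⟨stageIso hU f⟩⟩

section

variable (V : Type u') [Category.{v'} V] [MonoidalCategory V]
  [EnrichedOrdinaryCategory V M] [Φ.HasEnrichedProducts V]

variable (Φ) in
/-- The contravariant functoriality of the diagram of mapping objects. -/
@[simps]
def mapDiagramWhiskerRight {X X' : M} (a : X ⟶ X') (Y : M) :
    Φ.mapDiagram V X' Y ⟶ Φ.mapDiagram V X Y where
  app U := eHomWhiskerRight V (prod.map a (𝟙 U.unop.obj)) (Y ⨯ U.unop.obj)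
  naturality U W h := by
    have := eHomWhiskerRight_trans V Y h.unop (prod.map a (𝟙 U.unop.obj))
    rw [res_prodMap W.unop.property] at this
    exact this.symm

variable (Φ) in
/-- The covariant functoriality of the diagram of mapping objects. -/
@[simps]
def mapDiagramWhiskerLeft (X : M) {Y Y' : M} (b : Y ⟶ Y') :
    Φ.mapDiagram V X Y ⟶ Φ.mapDiagram V X Y' where
  app U := eHomWhiskerLeft V (X ⨯ U.unop.obj) (prod.map b (𝟙 U.unop.obj))
  naturality U W h := by
    have := eHomWhiskerLeft_trans V X h.unop (prod.map b (𝟙 U.unop.obj))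
    rw [res_prodMap W.unop.property] at this
    exact this.symm

namespace InducedEnrichment

variable {V} [EnrichedOrdinaryCategory V Φ.QuotientCat] (I : Φ.InducedEnrichment V)

lemma inc_eHomWhiskerRight_proj_map {X X' : M} (a : X ⟶ X') (Y : M)
    (U : Φ.mem.FullSubcategory) :
    I.inc X' Y U ≫ eHomWhiskerRight V (Φ.proj.map a) (Φ.proj.obj Y) =
      eHomWhiskerRight V (prod.map a (𝟙 U.obj)) (Y ⨯ U.obj) ≫ I.inc X Y U := by
  rw [← stage_prodMap U.property, inc_eHomWhiskerRight]

lemma inc_eHomWhiskerLeft_proj_map (X : M) {Y Y' : M} (b : Y ⟶ Y')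
    (U : Φ.mem.FullSubcategory) :
    I.inc X Y U ≫ eHomWhiskerLeft V (Φ.proj.obj X) (Φ.proj.map b) =
      eHomWhiskerLeft V (X ⨯ U.obj) (prod.map b (𝟙 U.obj)) ≫ I.inc X Y' U := by
  rw [← stage_prodMap U.property, inc_eHomWhiskerLeft]

variable [HasColimitsOfShape (Φ.mem.FullSubcategory)ᵒᵖ V]

/-- The mapping objects of the quotient are colimits. -/
def colimitIso (X Y : M) : colimit (Φ.mapDiagram V X Y) ≅ (Φ.proj.obj X ⟶[V] Φ.proj.obj Y) :=
  (colimit.isColimit _).coconePointUniqueUpToIso (I.isColimit X Y)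

@[simp]
lemma ι_colimitIso_hom (X Y : M) (U : (Φ.mem.FullSubcategory)ᵒᵖ) :
    colimit.ι (Φ.mapDiagram V X Y) U ≫ (I.colimitIso X Y).hom = I.inc X Y U.unop :=
  (colimit.isColimit _).comp_coconePointUniqueUpToIso_hom (I.isColimit X Y) U

/-- Mapping objects are filtered colimits and these commute with pullbacks, so the pullback-power
downstairs is the colimit of the pullback-powers at the stages. -/
lemma pullbackPower_proj_map (I : Φ.InducedEnrichment V) [ModelCategory V]
    [HasExactColimitsOfShape (Φ.mem.FullSubcategory)ᵒᵖ V]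
    {S : MorphismProperty V} [S.RespectsIso]
    [S.IsStableUnderColimitsOfShape (Φ.mem.FullSubcategory)ᵒᵖ] {A B X Y : M} (i : A ⟶ B)
    (p : Y ⟶ X)
    (h : ∀ U : Φ.mem.FullSubcategory,
      S (pullbackPower V (prod.map i (𝟙 U.obj)) (prod.map p (𝟙 U.obj)))) :
    S (pullbackPower V (Φ.proj.map i) (Φ.proj.map p)) := by
  let r := Φ.mapDiagramWhiskerRight V i X
  let l := Φ.mapDiagramWhiskerLeft V A p
  have sq := IsPullback.of_hasPullback r l
  have sq' : IsPullback (colim.map (pullback.fst r l) ≫ (I.colimitIso B X).hom)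
      (colim.map (pullback.snd r l) ≫ (I.colimitIso A Y).hom)
      (eHomWhiskerRight V (Φ.proj.map i) (Φ.proj.obj X))
      (eHomWhiskerLeft V (Φ.proj.obj A) (Φ.proj.map p)) := by
    -- Exactness of `colim` along the filter is used here.
    refine (sq.map colim).of_iso (Iso.refl _) (I.colimitIso B X) (I.colimitIso A Y)
      (I.colimitIso A X) (by simp) (by simp) (colimit.hom_ext fun U => ?_)
      (colimit.hom_ext fun U => ?_)
    · simp only [colim_map, ι_colimMap_assoc, ι_colimitIso_hom, reassoc_of% ι_colimitIso_hom]
      exact (I.inc_eHomWhiskerRight_proj_map i X U.unop).symm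
    · simp only [colim_map, ι_colimMap_assoc, ι_colimitIso_hom, reassoc_of% ι_colimitIso_hom]
      exact (I.inc_eHomWhiskerLeft_proj_map A p U.unop).symm
  let f : Φ.mapDiagram V B Y ⟶ pullback r l :=
    pullback.lift (Φ.mapDiagramWhiskerLeft V B p) (Φ.mapDiagramWhiskerRight V i Y) (by
      ext U
      exact eHom_whisker_exchange V _ _)
  have hf₁ (U) : f.app U ≫ (pullback.fst r l).app U = (Φ.mapDiagramWhiskerLeft V B p).app U := by
    rw [← NatTrans.comp_app, pullback.lift_fst]
  have hf₂ (U) : f.app U ≫ (pullback.snd r l).app U =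
      (Φ.mapDiagramWhiskerRight V i Y).app U := by
    rw [← NatTrans.comp_app, pullback.lift_snd]
  refine (pullbackPower_iff_of_isPullback _ _ sq' (sq'.lift _ _ (eHom_whisker_exchange V _ _))
    (sq'.lift_fst _ _ _) (sq'.lift_snd _ _ _)).2 ?_
  refine MorphismProperty.IsStableUnderColimitsOfShape.condition
    (J := (Φ.mem.FullSubcategory)ᵒᵖ) _ _ _ _ (I.isColimit B Y) (colimit.isColimit (pullback r l))
    f (fun U => ?_) _ fun U => ?_
  -- Pullbacks of diagrams are computed pointwise, so each component of `f` is a pullback-power at a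
  -- stage.
  · exact (pullbackPower_iff_of_isPullback _ _ (sq.app U) (f.app U) (hf₁ U) (hf₂ U)).1 (h U.unop)
  · apply sq'.hom_ext
    · refine Eq.trans ?_ (Category.assoc _ _ _).symm
      rw [Category.assoc, sq'.lift_fst, colim_map, colimit.cocone_ι, ι_colimMap_assoc,
        ι_colimitIso_hom]
      exact (I.inc_eHomWhiskerLeft_proj_map B p U.unop).trans
        (congr($((hf₁ U).symm) ≫ I.inc B X U.unop).trans (Category.assoc _ _ _))
    · refine Eq.trans ?_ (Category.assoc _ _ _).symm
      rw [Category.assoc, sq'.lift_snd, colim_map, colimit.cocone_ι, ι_colimMap_assoc,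
        ι_colimitIso_hom]
      exact (I.inc_eHomWhiskerRight_proj_map i Y U.unop).trans
        (congr($((hf₂ U).symm) ≫ I.inc A Y U.unop).trans (Category.assoc _ _ _))

/-- Pullback-powers depend on arrows only up to isomorphism, so both arrows may be taken in the
image of `P_Φ`. -/
lemma pullbackPower_of_quotientClass (I : Φ.InducedEnrichment V) [ModelCategory V]
    [HasExactColimitsOfShape (Φ.mem.FullSubcategory)ᵒᵖ V]
    {S : MorphismProperty V} [S.RespectsIso]
    [S.IsStableUnderColimitsOfShape (Φ.mem.FullSubcategory)ᵒᵖ]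
    {P Q : MorphismProperty M} [Φ.ProdStable P] [Φ.ProdStable Q]
    (h : ∀ {A B X Y : M} (i : A ⟶ B) (p : Y ⟶ X), P i → Q p → S (pullbackPower V i p))
    {A B X Y : Φ.QuotientCat} {i : A ⟶ B} {p : Y ⟶ X} (hi : Φ.quotientClass P i)
    (hp : Φ.quotientClass Q p) : S (pullbackPower V i p) := by
  obtain ⟨_, _, i, hi, ⟨e⟩⟩ := hi.exists_arrow_iso
  obtain ⟨_, _, p, hp, ⟨e'⟩⟩ := hp.exists_arrow_iso
  exact (pullbackPower_iff_of_iso e e').1 (I.pullbackPower_proj_map i p fun U =>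
    h _ _ (ProdStable.prodMap U.property i hi) (ProdStable.prodMap U.property p hp))

end InducedEnrichment

end

end ModelFilter

namespace ModelFilter

variable {V : Type u'} [Category.{v'} V] [MonoidalCategory V] [ModelCategory V]
  {M : Type u} [Category.{v} M] [ModelCategory M] (Φ : ModelFilter M)

/-! ### Essentially small filters -/

section EssentiallySmall

variable [EssentiallySmall.{w} Φ.mem.FullSubcategory]

/-- A small category equivalent to the opposite of an essentially small filter. -/
abbrev SmallIndex : Type w := SmallModel.{w} (Φ.mem.FullSubcategory)ᵒᵖ

/-- The opposite of an essentially small filter is equivalent to a small category. -/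
abbrev smallIndexEquiv : Φ.SmallIndex ≌ (Φ.mem.FullSubcategory)ᵒᵖ :=
  (equivSmallModel.{w} (Φ.mem.FullSubcategory)ᵒᵖ).symm

instance : IsFiltered Φ.SmallIndex := .of_equivalence Φ.smallIndexEquiv.symm

/-- The assumptions on `V` concern `w`-small index categories, whereas the filter is only equivalent
to one. -/
lemma preservesColimitsOfShape_of_preservesFilteredColimits {C D : Type*} [Category* C]
    [Category* D] (F : C ⥤ D) (hF : PreservesFilteredColimitsOfSize.{w, w} F) :
    PreservesColimitsOfShape (Φ.mem.FullSubcategory)ᵒᵖ F :=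
  have := hF.preserves_filtered_colimits Φ.SmallIndex
  preservesColimitsOfShape_of_equiv Φ.smallIndexEquiv F

instance (K : V) [IsFinitelyPresentable.{w} K] :
    PreservesColimitsOfShape (Φ.mem.FullSubcategory)ᵒᵖ (coyoneda.obj (op K)) :=
  Φ.preservesColimitsOfShape_of_preservesFilteredColimits _ inferInstance

lemma isStableUnderColimitsOfShape_of_isStableUnderFilteredColimits {C : Type*} [Category* C]
    {S : MorphismProperty C}
    (hS : MorphismProperty.IsStableUnderFilteredColimits.{w, w} S) :
    S.IsStableUnderColimitsOfShape (Φ.mem.FullSubcategory)ᵒᵖ := by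
  have := hS.isStableUnderColimitsOfShape Φ.SmallIndex
  rwa [MorphismProperty.isStableUnderColimitsOfShape_iff_colimitsOfShape_le,
    ← S.colimitsOfShape_eq_of_equivalence Φ.smallIndexEquiv,
    ← MorphismProperty.isStableUnderColimitsOfShape_iff_colimitsOfShape_le]

lemma hasFilterColimits_of_quotientCompatible [QuotientCompatible.{w} V] :
    Φ.HasFilterColimits V where
  hasColimitsOfShape := hasColimitsOfShape_of_equivalence Φ.smallIndexEquiv
  preserves_tensorLeft X := Φ.preservesColimitsOfShape_of_preservesFilteredColimits _
    (QuotientCompatible.preserves_tensorLeft X)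
  preserves_tensorRight X := Φ.preservesColimitsOfShape_of_preservesFilteredColimits _
    (QuotientCompatible.preserves_tensorRight X)
  preserves_unit :=
    have : IsFinitelyPresentable.{w} (𝟙_ V) := QuotientCompatible.compact_unit
    inferInstance

end EssentiallySmall

/-! ### The enriched model structure -/

instance : Φ.ProdStable (trivialFibrations M) :=
  inferInstanceAs (Φ.ProdStable (fibrations M ⊓ weakEquivalences M))

instance : Φ.ProdStable (trivialCofibrations M) :=
  inferInstanceAs (Φ.ProdStable (cofibrations M ⊓ weakEquivalences M))

variable {Φ}

/-- The compactly enriched structure of the quotient. -/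
abbrev InducedEnrichment.compactlyEnriched [CompactlyEnriched.{w} V M]
    [Φ.HasEnrichedProducts V] [Φ.IsEnriched V] [EnrichedOrdinaryCategory V Φ.QuotientCat]
    (I : Φ.InducedEnrichment V) [HasColimitsOfShape (Φ.mem.FullSubcategory)ᵒᵖ V]
    [HasExactColimitsOfShape (Φ.mem.FullSubcategory)ᵒᵖ V]
    [∀ K : Compact.{w} V,
      PreservesColimitsOfShape (Φ.mem.FullSubcategory)ᵒᵖ (coyoneda.obj (op K.obj))]
    [(fibrations V).IsStableUnderColimitsOfShape (Φ.mem.FullSubcategory)ᵒᵖ]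
    [(trivialFibrations V).IsStableUnderColimitsOfShape (Φ.mem.FullSubcategory)ᵒᵖ]
    (hΦ : ∀ U : M, Φ.mem U → PreservesColimitsOfShape WalkingSpan (prod.functor.obj U)) :
    letI := modelCategoryQuotientCat hΦ
    CompactlyEnriched.{w} V Φ.QuotientCat :=
  letI := modelCategoryQuotientCat hΦ
  { tensor := I.universalTensors.functor
    cotensor := I.universalCotensors.functor
    tensorEquiv := I.universalTensors.equiv
    cotensorEquiv := I.universalCotensors.equiv
    tensorEquiv_naturality := I.universalTensors.equiv_naturality
    cotensorEquiv_naturality := I.universalCotensors.equiv_naturality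
    fibration_pullbackPower _ _ hi hp :=
      ⟨I.pullbackPower_of_quotientClass (S := fibrations V) (P := cofibrations M)
        (Q := fibrations M) (fun i p hi hp =>
          have : Cofibration i := ⟨hi⟩
          have : Fibration p := ⟨hp⟩
          (CompactlyEnriched.fibration_pullbackPower i p).mem) hi.mem hp.mem⟩
    -- Only fibrations and trivial fibrations of `V` are known to be closed under filtered colimits,
    -- so triviality is proved for trivial fibrations as a whole.
    weakEquivalence_pullbackPower_left _ _ hi hp hi' :=
      ⟨(I.pullbackPower_of_quotientClass (S := trivialFibrations V)
        (P := trivialCofibrations M) (Q := fibrations M) (fun i p hi hp =>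
          have : Cofibration i := ⟨hi.1⟩
          have : WeakEquivalence i := ⟨hi.2⟩
          have : Fibration p := ⟨hp⟩
          ⟨(CompactlyEnriched.fibration_pullbackPower i p).mem,
            (CompactlyEnriched.weakEquivalence_pullbackPower_left i p).mem⟩)
        ((quotientClass_inf (cofibrations M) (weakEquivalences M)).ge _ ⟨hi.mem, hi'.mem⟩)
          hp.mem).2⟩
    weakEquivalence_pullbackPower_right _ _ hi hp hp' :=
      ⟨(I.pullbackPower_of_quotientClass (S := trivialFibrations V)
        (P := cofibrations M) (Q := trivialFibrations M) (fun i p hi hp =>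
          have : Cofibration i := ⟨hi⟩
          have : Fibration p := ⟨hp.1⟩
          have : WeakEquivalence p := ⟨hp.2⟩
          ⟨(CompactlyEnriched.fibration_pullbackPower i p).mem,
            (CompactlyEnriched.weakEquivalence_pullbackPower_right i p).mem⟩) hi.mem
        ((quotientClass_inf (fibrations M) (weakEquivalences M)).ge _
          ⟨hp.mem, hp'.mem⟩)).2⟩ }

end ModelFilter

end

end FilterQuotientModel

theorem mainTheorem5
    (V : Type u') [Category.{v'} V] [MonoidalCategory V] [ModelCategory V]
    [FilterQuotientModel.MonoidalModelCategory V]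
    [FilterQuotientModel.QuotientCompatible.{w} V]
    [AB5OfSize.{w, w} V]
    (M : Type u) [Category.{v} M] [ModelCategory M]
    [FilterQuotientModel.CompactlyEnriched.{w} V M]
    (Φ : FilterQuotientModel.ModelFilter M)
    [EssentiallySmall.{w} Φ.mem.FullSubcategory]
    [Φ.IsEnriched V] [Φ.HasEnrichedProducts V]
    (hΦ : ∀ U : M, Φ.mem U → PreservesColimitsOfShape WalkingSpan (prod.functor.obj U)) :
    ∃ _ : ModelCategory Φ.QuotientCat,
      fibrations Φ.QuotientCat = Φ.quotientClass (fibrations M) ∧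
      cofibrations Φ.QuotientCat = Φ.quotientClass (cofibrations M) ∧
      weakEquivalences Φ.QuotientCat = Φ.quotientClass (weakEquivalences M) ∧
      ∃ (_ : FilterQuotientModel.CompactlyEnriched.{w} V Φ.QuotientCat)
        (I : Φ.InducedEnrichment V),
        ∀ (U : Φ.mem.FullSubcategory) (K : FilterQuotientModel.Compact.{w} V) (X : M),
          IsIso (Φ.tensComparison I U X K) ∧ IsIso (Φ.cotensComparison I U K X) := by
  have := Φ.hasFilterColimits_of_quotientCompatible (V := V)
  have : HasExactColimitsOfShape (Φ.mem.FullSubcategory)ᵒᵖ V :=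
    HasExactColimitsOfShape.of_domain_equivalence V Φ.smallIndexEquiv
  have (K : FilterQuotientModel.Compact.{w} V) :
      PreservesColimitsOfShape (Φ.mem.FullSubcategory)ᵒᵖ (coyoneda.obj (op K.obj)) :=
    have : IsFinitelyPresentable.{w} K.obj := K.property
    inferInstance
  have := Φ.isStableUnderColimitsOfShape_of_isStableUnderFilteredColimits
    (FilterQuotientModel.QuotientCompatible.fibrations_stable (V := V))
  have := Φ.isStableUnderColimitsOfShape_of_isStableUnderFilteredColimits
    (FilterQuotientModel.QuotientCompatible.trivialFibrations_stable (V := V))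
  let I := Φ.inducedEnrichment V
  let _ := FilterQuotientModel.ModelFilter.modelCategoryQuotientCat hΦ
  let _ := I.compactlyEnriched hΦ
  -- The tensor of `P_Φ X` is by construction `P_Φ (X ⊗ K)`, and likewise for cotensors, so the
  -- comparison maps are classified by the universal arrows, up to the choice of stage.
  exact ⟨inferInstance, rfl, rfl, rfl, inferInstance, I, fun U K X =>
    ⟨I.universalTensors.isIso_equiv_symm congr(
      FilterQuotientModel.tensUnit V X K ≫ $(I.projMap_eq U Φ.someMem _ _)),
      I.universalCotensors.isIso_equiv_symm
        congr(FilterQuotientModel.cotensCounit V K X ≫ $(I.projMap_eq U Φ.someMem _ _))⟩⟩
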